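/- For an integer $s\ge 1$ (the number of servers) and $\delta\le\sqrt s$ put $$f_s(\delta)=\sqrt s\,\Bigl(1-\frac{\delta}{\sqrt s}\Bigr)B(s,s-\delta\sqrt s),\qquad B(s,\lambda)=\frac{\lambda^s/s!}{\sum_{k=0}^{s}\lambda^k/k!},$$ where $B$ is the Erlang B formula. For $0<\gamma<\sqrt s$ let $a_s(\gamma)$ be the solution $a$ (with $\gamma-a\le\sqrt s$) of the Cohen equation $a=f_s(\gamma-a)$, which exists and is unique, and let $$L_s(\gamma)=\frac{(\sqrt s-\gamma)^2}{\sqrt s-\gamma+a_s(\gamma)},\qquad 0<\gamma<\sqrt s .$$ For $\gamma>0$ let $a_\infty(\gamma)$ be the solution, which exists and is unique, of $a=\varphi(\gamma-a)/\Phi(\gamma-a)$, where $\varphi$ and $\Phi$ are the standard normal density and distribution function. **Theorem.** For every integer $s\ge1$ the function $L_s$ has a unique maximizer $\hat\gamma_s$ on $(0,\sqrt s)$. The sequence $\hat\gamma_s$ increases strictly in $s\ge 1$, from $\hat\gamma_1=1/2$ to the limit $\hat\gamma_\infty=1.034113459\ldots$ as $s\to\infty$ (that is, $1.034113459\le\hat\gamma_\infty<1.034113460$).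 The function $\gamma\,a_\infty(\gamma)$ decreases strictly on $(0,\infty)$, with limit $1$ as $\gamma\downarrow0$ and limit $0$ as $\gamma\to\infty$, and $\hat\gamma_\infty$ is the unique root $\gamma>0$ of $\gamma\,a_\infty(\gamma)=\tfrac12$. -/

import Mathlib

open Set Filter Topology

noncomputable section

/-- The Erlang B formula `B(s,λ) = (λ^s/s!) / ∑_{k=0}^s λ^k/k!`. -/
def erlangB (s : ℕ) (l : ℝ) : ℝ :=
  (l ^ s / (s.factorial : ℝ)) / ∑ k ∈ Finset.range (s + 1), l ^ k / (k.factorial : ℝ)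

/-- `f_s(δ) = √s (1 - δ/√s) B(s, s - δ√s)`, of interest for `δ ≤ √s`. -/
def fErlang (s : ℕ) (δ : ℝ) : ℝ :=
  √(s : ℝ) * (1 - δ / √(s : ℝ)) * erlangB s ((s : ℝ) - δ * √(s : ℝ))

/-- `a` solves the Cohen equation `a = f_s(γ - a)`, the argument `γ - a` being in the domain
`(-∞, √s]` of `f_s` (equivalently, the total arrival rate `s - (γ - a)√s` is nonnegative). -/
def IsCohenSol (s : ℕ) (γ a : ℝ) : Prop :=
  γ - a ≤ √(s : ℝ) ∧ a = fErlang s (γ - a)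

/-- `a_s(γ)`, the solution of the Cohen equation. -/
def cohenA (s : ℕ) (γ : ℝ) : ℝ :=
  Classical.epsilon (IsCohenSol s γ)

/-- The normalized carried traffic `L_s(γ) = (√s - γ)² / (√s - γ + a_s(γ))`, `0 < γ < √s`. -/
def carriedL (s : ℕ) (γ : ℝ) : ℝ :=
  (√(s : ℝ) - γ) ^ 2 / (√(s : ℝ) - γ + cohenA s γ)

/-- `γ` is a maximizer of `L_s` on the open interval `(0, √s)`. -/
def IsMaximizerL (s : ℕ) (γ : ℝ) : Prop :=
  γ ∈ Ioo (0 : ℝ) (√(s : ℝ)) ∧ IsMaxOn (carriedL s) (Ioo (0 : ℝ) (√(s : ℝ))) γ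

/-- `γ̂_s`, the maximizer of `L_s` on `(0, √s)`. -/
def gammaHat (s : ℕ) : ℝ :=
  Classical.epsilon (IsMaximizerL s)

/-- `f_∞(δ) = φ(δ)/Φ(δ)`, with the standard normal density and distribution function. -/
def fInfty (δ : ℝ) : ℝ :=
  ProbabilityTheory.gaussianPDFReal 0 1 δ /
    ProbabilityTheory.cdf (ProbabilityTheory.gaussianReal 0 1) δ

/-- `a_∞(γ)`, the solution of the limiting Cohen equation `a = f_∞(γ - a)`. -/
def cohenAInfty (γ : ℝ) : ℝ :=
  Classical.epsilon fun a : ℝ => a = fInfty (γ - a)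

end

/-! Parametrize by the total arrival rate L = s - (γ - a)√s. With R = 1/B(s, L) and N = s - L + L/R,
the mean number of idle servers, the Cohen equation becomes N(L) = γ√s. Since N decreases strictly
from s to 0, it has one solution (`isCohenSol_iff`). The objective becomes L(1 - 1/R)²/√s, whose
derivative in L has the sign of 1 - 2N/(R - 1). A Wronskian argument shows that N/(R - 1) increases
strictly (`idleRatio_strictMonoOn`), and it crosses 1/2; this gives the unique maximizer.

At the maximizer, with c = γ√s idle servers, R = 1 + 2c forces L = (s - c)(1 + 2c)/(2c). Hence the
position of any γ relative to the maximizer can be read off from the sign of R - (1 + 2c) at this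
explicit rate (`compare_gammaHat`). Both monotonicity in s and the limit rest on this criterion.

For monotonicity, the recursion turns the criterion at s + 1 into a bound on R at the old rate with
s servers. A third order Taylor bound, valid because R is completely monotone in L, carries it to
the new rate. With w = √(s+1) + √s everything is rational in γ and w, and the claim reduces to
positivity of one polynomial (`critPoly_pos`). The argument needs s ≥ 2 and γ ≥ 3/5, so s = 1 and
the bound at s = 2 are computed directly.

For the limit, R is an integral, and dominated convergence gives R/√s → Φ(δ)/φ(δ) at δ = γ - 1/(2γ).
The limiting criterion compares this Mills ratio with 2γ, that is, γ a_∞(γ) with 1/2. Moreover γ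
a_∞(γ) is one minus the variance of a normal law truncated to (0, ∞); positivity of the third
cumulant makes it strictly decreasing in the mean (`truncGap_strictAnti`). The digits follow from
rigorous bounds on the Mills ratio. -/

/-! ### The reciprocal Erlang B formula -/

/-- The reciprocal `1 / B(s, L)` of the Erlang B formula, by its recursion in `s`. -/
noncomputable def erlangR : ℕ → ℝ → ℝ
  | 0, _ => 1
  | s + 1, L => 1 + (s + 1) / L * erlangR s L

theorem erlangR_succ (s : ℕ) (L : ℝ) : erlangR (s + 1) L = 1 + (s + 1) / L * erlangR s L := rfl

theorem one_le_erlangR (s : ℕ) {L : ℝ} (hL : 0 < L) : 1 ≤ erlangR s L := by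
  induction s with
  | zero => simp [erlangR]
  | succ s ih =>
    rw [erlangR_succ]
    have : 0 ≤ (s + 1 : ℝ) / L * erlangR s L := by positivity
    linarith

theorem erlangR_pos (s : ℕ) {L : ℝ} (hL : 0 < L) : 0 < erlangR s L :=
  lt_of_lt_of_le one_pos (one_le_erlangR s hL)

theorem one_lt_erlangR {s : ℕ} (hs : 1 ≤ s) {L : ℝ} (hL : 0 < L) : 1 < erlangR s L := by
  obtain ⟨k, rfl⟩ : ∃ k, s = k + 1 := ⟨s - 1, by omega⟩
  rw [erlangR_succ]
  have := erlangR_pos k hL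
  have : 0 < (k + 1 : ℝ) / L * erlangR k L := by positivity
  linarith

theorem erlangR_mul_pow (s : ℕ) {L : ℝ} (hL : 0 < L) :
    erlangR s L * (L ^ s / (s.factorial : ℝ)) =
      ∑ k ∈ Finset.range (s + 1), L ^ k / (k.factorial : ℝ) := by
  induction s with
  | zero => simp [erlangR]
  | succ s ih =>
    rw [Finset.sum_range_succ, ← ih, erlangR_succ, Nat.factorial_succ]
    have : (s.factorial : ℝ) ≠ 0 := by positivity
    push_cast
    field_simp
    ring

theorem erlangB_eq_inv (s : ℕ) {L : ℝ} (hL : 0 < L) : erlangB s L = (erlangR s L)⁻¹ := by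
  have h := erlangR_pos s hL
  rw [erlangB, ← erlangR_mul_pow s hL]
  have : (s.factorial : ℝ) ≠ 0 := by positivity
  field_simp

theorem hasDerivAt_erlangR (s : ℕ) {L : ℝ} (hL : 0 < L) :
    HasDerivAt (erlangR s) (erlangR s L * (1 - s / L) - 1) L := by
  induction s with
  | zero => simpa [erlangR] using hasDerivAt_const L (1 : ℝ)
  | succ s ih =>
    have h := (((hasDerivAt_const L ((s : ℝ) + 1)).div (hasDerivAt_id L) hL.ne').mul ih).const_add 1
    refine h.congr_deriv ?_
    rw [erlangR_succ]
    simp only [id, Pi.div_apply]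
    push_cast
    field_simp
    ring

theorem tendsto_erlangR_atTop (s : ℕ) : Tendsto (erlangR s) atTop (𝓝 1) := by
  induction s with
  | zero => exact tendsto_const_nhds
  | succ s ih =>
    have h := ((tendsto_const_nhds (x := (s : ℝ) + 1)).div_atTop tendsto_id).mul ih
    simpa [erlangR] using h.const_add 1

/-! ### The mean number of idle servers -/

/-- The mean number of idle servers `s - L (1 - B(s, L))`. -/
noncomputable def meanIdle (s : ℕ) (L : ℝ) : ℝ := s - L + L / erlangR s L

theorem meanIdle_zero (L : ℝ) : meanIdle 0 L = 0 := by simp [meanIdle, erlangR]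

theorem erlangR_mul_meanIdle (s : ℕ) {L : ℝ} (hL : 0 < L) :
    erlangR s L * meanIdle s L = erlangR s L * (s - L) + L := by
  have := erlangR_pos s hL
  rw [meanIdle]; field_simp

/-- The recursion for `erlangR` becomes a fractional linear recursion for N with positive
coefficients, so nonnegativity follows by induction from N = 0 at s = 0. -/
theorem meanIdle_succ_aux (s : ℕ) {L : ℝ} (hL : 0 < L) :
    0 ≤ meanIdle s L ∧
      meanIdle (s + 1) L = (s + 1) * (1 + meanIdle s L) / (L + 1 + meanIdle s L) := by
  have key : ∀ s : ℕ, 0 ≤ meanIdle s L →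
      meanIdle (s + 1) L = (s + 1) * (1 + meanIdle s L) / (L + 1 + meanIdle s L) := by
    intro s h0
    have h := erlangR_pos s hL
    have hN : L + 1 + meanIdle s L = (L + (s + 1) * erlangR s L) / erlangR s L := by
      rw [meanIdle]; field_simp; ring
    have hN1 : 1 + meanIdle s L = (L + (s + 1) * erlangR s L) / erlangR s L - L := by
      rw [← hN]; ring
    rw [hN, hN1, meanIdle, erlangR_succ]
    have : 0 < L + (s + 1) * erlangR s L := by positivity
    push_cast
    field_simp
    ring
  have h0 : 0 ≤ meanIdle s L := by
    induction s with
    | zero => rw [meanIdle_zero]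
    | succ s ih => rw [key s ih]; positivity
  exact ⟨h0, key s h0⟩

theorem meanIdle_nonneg (s : ℕ) {L : ℝ} (hL : 0 < L) : 0 ≤ meanIdle s L :=
  (meanIdle_succ_aux s hL).1

theorem meanIdle_succ (s : ℕ) {L : ℝ} (hL : 0 < L) :
    meanIdle (s + 1) L = (s + 1) * (1 + meanIdle s L) / (L + 1 + meanIdle s L) :=
  (meanIdle_succ_aux s hL).2

theorem meanIdle_pos {s : ℕ} (hs : 1 ≤ s) {L : ℝ} (hL : 0 < L) : 0 < meanIdle s L := by
  obtain ⟨k, rfl⟩ : ∃ k, s = k + 1 := ⟨s - 1, by omega⟩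
  rw [meanIdle_succ k hL]
  have := meanIdle_nonneg k hL
  positivity

theorem meanIdle_lt_succ (s : ℕ) {L : ℝ} (hL : 0 < L) : meanIdle s L < meanIdle (s + 1) L := by
  induction s with
  | zero => rw [meanIdle_zero]; exact meanIdle_pos le_rfl hL
  | succ s ih =>
    have h1 := meanIdle_nonneg s hL
    have h2 := meanIdle_nonneg (s + 1) hL
    rw [meanIdle_succ (s + 1) hL]
    nth_rewrite 1 [meanIdle_succ s hL]
    rw [div_lt_div_iff₀ (by positivity) (by positivity)]
    push_cast
    have : (0 : ℝ) ≤ s := by positivity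
    set a := meanIdle s L
    set b := meanIdle (s + 1) L
    have e : ((s : ℝ) + 1 + 1) * (1 + b) * (L + 1 + a) - (s + 1) * (1 + a) * (L + 1 + b)
        = (s + 1) * (L * (b - a)) + (1 + b) * (L + 1 + a) := by ring
    have : 0 < L * (b - a) := mul_pos hL (by linarith)
    have : 0 < (s + 1) * (L * (b - a)) + (1 + b) * (L + 1 + a) := by positivity
    linarith

theorem meanIdle_lt (s : ℕ) (hs : 1 ≤ s) {L : ℝ} (hL : 0 < L) : meanIdle s L < s := by
  have h := one_lt_erlangR hs hL
  have : L / erlangR s L < L := div_lt_self hL h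
  rw [meanIdle]; linarith

theorem sub_le_meanIdle (s : ℕ) {L : ℝ} (hL : 0 < L) : s - L ≤ meanIdle s L := by
  have := erlangR_pos s hL
  have : 0 ≤ L / erlangR s L := by positivity
  rw [meanIdle]; linarith

/-! ### Monotonicity of the idle ratio -/

/-- The ratio `N / (1/B - 1)`; it equals the difference of the carried loads of `s` and `s - 1`
servers. -/
noncomputable def idleRatio (s : ℕ) (L : ℝ) : ℝ := meanIdle s L / (erlangR s L - 1)

theorem idleRatio_lt_one {s : ℕ} (hs : 1 ≤ s) {L : ℝ} (hL : 0 < L) : idleRatio s L < 1 := by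
  obtain ⟨k, rfl⟩ : ∃ k, s = k + 1 := ⟨s - 1, by omega⟩
  have h := meanIdle_lt_succ k hL
  have h1 := erlangR_pos k hL
  have e : idleRatio (k + 1) L = 1 - (meanIdle (k + 1) L - meanIdle k L) := by
    rw [idleRatio, meanIdle, meanIdle, erlangR_succ]
    have : 0 < L + (k + 1) * erlangR k L := by positivity
    push_cast
    field_simp
    ring
  linarith

theorem idleRatio_le {s : ℕ} (hs : 1 ≤ s) {L : ℝ} (hL : 0 < L) : idleRatio s L ≤ L := by
  have h0 := meanIdle_lt s hs hL
  have h1 := one_lt_erlangR hs hL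
  rw [idleRatio, div_le_iff₀ (by linarith)]
  obtain ⟨k, rfl⟩ : ∃ k, s = k + 1 := ⟨s - 1, by omega⟩
  rw [erlangR_succ]
  have h2 := one_le_erlangR k hL
  have e : L * (1 + (k + 1) / L * erlangR k L - 1) = (k + 1) * erlangR k L := by
    field_simp; ring
  rw [e]
  push_cast at h0
  have : (0 : ℝ) ≤ k := by positivity
  nlinarith

theorem exists_half_lt_idleRatio {s : ℕ} (hs : 1 ≤ s) (L₀ : ℝ) :
    ∃ L > L₀, 0 < L ∧ 1 / 2 < idleRatio s L := by
  obtain ⟨k, rfl⟩ : ∃ k, s = k + 1 := ⟨s - 1, by omega⟩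
  -- The thresholds 3/2 and 3 are matched: (3/2)/2 times the factor 4/3 bounding (L + 1 + N)/(L(1 +
  -- N)) is exactly 1.
  have h1 : ∀ᶠ L in atTop, erlangR k L < 3 / 2 :=
    (tendsto_erlangR_atTop k).eventually_lt_const (by norm_num)
  obtain ⟨L, h2, h3, h4⟩ := (h1.and ((eventually_gt_atTop L₀).and (eventually_gt_atTop 3))).exists
  have hL : 0 < L := by linarith
  refine ⟨L, h3, hL, ?_⟩
  have hr := erlangR_pos k hL
  rw [idleRatio, lt_div_iff₀ (by linarith [one_lt_erlangR (Nat.le_add_left 1 k) hL]),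
    meanIdle_succ k hL, erlangR_succ, lt_div_iff₀ (by linarith [meanIdle_nonneg k hL])]
  have hN := meanIdle_nonneg k hL
  have e : 1 / 2 * (1 + ((k : ℝ) + 1) / L * erlangR k L - 1) * (L + 1 + meanIdle k L)
      = (k + 1) * (erlangR k L / 2 * ((L + 1 + meanIdle k L) / L)) := by field_simp; ring
  rw [e]
  have h5 : (L + 1 + meanIdle k L) / L ≤ 4 / 3 * (1 + meanIdle k L) := by
    rw [div_le_iff₀ hL]; nlinarith
  have h6 : erlangR k L / 2 * ((L + 1 + meanIdle k L) / L) < 1 + meanIdle k L := by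
    calc _ ≤ erlangR k L / 2 * (4 / 3 * (1 + meanIdle k L)) := by gcongr
      _ < 1 + meanIdle k L := by nlinarith
  exact mul_lt_mul_of_pos_left h6 (by positivity)

theorem hasDerivAt_meanIdle (s : ℕ) {L : ℝ} (hL : 0 < L) :
    HasDerivAt (meanIdle s) (-1 + (1 + meanIdle s L) / erlangR s L) L := by
  have hr := erlangR_pos s hL
  have h := ((hasDerivAt_id L).const_sub (s : ℝ)).add
    ((hasDerivAt_id L).div (hasDerivAt_erlangR s hL) hr.ne')
  refine h.congr_deriv ?_
  simp only [id]
  rw [meanIdle]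
  field_simp
  ring

/-- The derivative is negative exactly when 1 + N < R, which is the bound `idleRatio_lt_one`. -/
theorem meanIdle_strictAntiOn {s : ℕ} (hs : 1 ≤ s) : StrictAntiOn (meanIdle s) (Ioi 0) := by
  refine strictAntiOn_of_deriv_neg (convex_Ioi 0)
    (fun L hL => (hasDerivAt_meanIdle s hL).continuousAt.continuousWithinAt) fun L hL => ?_
  rw [interior_Ioi] at hL
  have hL : 0 < L := hL
  have h := idleRatio_lt_one hs hL
  have h1 := one_lt_erlangR hs hL
  rw [(hasDerivAt_meanIdle s hL).deriv]
  rw [idleRatio, div_lt_one (by linarith)] at h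
  have : (1 + meanIdle s L) / erlangR s L < 1 := by rw [div_lt_one (by linarith)]; linarith
  linarith

theorem exists_meanIdle_eq {s : ℕ} (hs : 1 ≤ s) {c : ℝ} (hc0 : 0 < c) (hc : c < s) :
    ∃ L > 0, meanIdle s L = c := by
  have hs0 : (1 : ℝ) ≤ s := by exact_mod_cast hs
  -- At a the bound N ≥ s - a suffices; b is chosen so that cb = cs + s², which makes the recursion
  -- give N ≤ c.
  set a : ℝ := (s - c) / 2
  set b : ℝ := s + s * s / c
  have ha : 0 < a := by simp only [a]; linarith
  have hss : 0 < (s * s : ℝ) / c := by positivity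
  have hab : a ≤ b := by simp only [a, b]; linarith
  have hcont : ContinuousOn (meanIdle s) (Icc a b) := fun L hL =>
    (hasDerivAt_meanIdle s (lt_of_lt_of_le ha hL.1)).continuousAt.continuousWithinAt
  have hA : c ≤ meanIdle s a := by
    have := sub_le_meanIdle s ha
    simp only [a] at this ⊢; linarith
  have hb : 0 < b := ha.trans_le hab
  have hB : meanIdle s b ≤ c := by
    obtain ⟨k, rfl⟩ : ∃ k, s = k + 1 := ⟨s - 1, by omega⟩
    have h1 := meanIdle_nonneg k hb
    have h2 : meanIdle k b ≤ k := by
      rcases Nat.eq_zero_or_pos k with rfl | hk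
      · simp [meanIdle_zero]
      · exact (meanIdle_lt k hk hb).le
    rw [meanIdle_succ k hb, div_le_iff₀ (by positivity)]
    push_cast at *
    have h3 : c * b = c * (k + 1) + (k + 1) * (k + 1) := by
      simp only [b]; field_simp; push_cast; ring
    nlinarith
  obtain ⟨L, hL, h⟩ := intermediate_value_Icc' hab hcont ⟨hB, hA⟩
  exact ⟨L, ha.trans_le hL.1, h⟩

theorem hasDerivAt_idleRatio {s : ℕ} (hs : 1 ≤ s) {L : ℝ} (hL : 0 < L) :
    HasDerivAt (idleRatio s)
      (idleRatio s L ^ 2 * erlangR s L / L - (1 - idleRatio s L) / erlangR s L) L := by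
  have hr := one_lt_erlangR hs hL
  have hr1 : erlangR s L - 1 ≠ 0 := by linarith
  have hr0 : erlangR s L ≠ 0 := by linarith
  have h := (hasDerivAt_meanIdle s hL).div ((hasDerivAt_erlangR s hL).sub_const 1) hr1
  refine h.congr_deriv ?_
  have e : erlangR s L * (1 - s / L) - 1 = -(erlangR s L * meanIdle s L) / L := by
    rw [erlangR_mul_meanIdle s hL]; field_simp; ring
  rw [e, idleRatio]
  field_simp
  ring

/-- A positive multiple of the derivative of `idleRatio s`, multiplied by an integrating factor. -/
noncomputable def idleWronskian (s : ℕ) (L : ℝ) : ℝ :=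
  L ^ s * Real.exp (-L) / erlangR s L *
    (meanIdle s L ^ 2 * erlangR s L ^ 2 -
      L * (erlangR s L - 1) * (erlangR s L - 1 - meanIdle s L))

theorem hasDerivAt_idleWronskian (s : ℕ) {L : ℝ} (hL : 0 < L) :
    HasDerivAt (idleWronskian s)
      (-(L ^ s * Real.exp (-L) / erlangR s L * ((erlangR s L - 1) *
        (erlangR s L - 1 - meanIdle s L) * (2 * meanIdle s L + 1)))) L := by
  have hr0 := erlangR_pos s hL
  have hR := (hasDerivAt_erlangR s hL)
  have e : erlangR s L * (1 - s / L) - 1 = -(erlangR s L * meanIdle s L) / L := by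
    rw [erlangR_mul_meanIdle s hL]; field_simp; ring
  rw [e] at hR
  have hN := hasDerivAt_meanIdle s hL
  have hp : HasDerivAt (fun x : ℝ => x ^ s) (s / L * L ^ s) L := by
    refine (hasDerivAt_pow s L).congr_deriv ?_
    rcases Nat.eq_zero_or_pos s with rfl | hs
    · simp
    · obtain ⟨k, rfl⟩ : ∃ k, s = k + 1 := ⟨s - 1, by omega⟩
      simp only [Nat.add_sub_cancel]
      field_simp
      ring
  have he : HasDerivAt (fun x : ℝ => Real.exp (-x)) (Real.exp (-L) * -1) L :=
    (hasDerivAt_neg L).exp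
  have h := ((hp.mul he).div hR hr0.ne').mul (((hN.pow 2).mul (hR.pow 2)).sub
    (((hasDerivAt_id L).mul (hR.sub_const 1)).mul ((hR.sub_const 1).sub hN)))
  refine h.congr_deriv ?_
  simp only [Pi.mul_apply, Pi.pow_apply, Pi.div_apply, Pi.sub_apply, id]
  -- Eliminating s leaves an identity in L, N, R and the two integrating factors, all of them free
  -- variables.
  have hs : (s : ℝ) = meanIdle s L + L - L / erlangR s L := by rw [meanIdle]; ring
  rw [hs]
  generalize meanIdle s L = N at *
  generalize erlangR s L = r at *
  generalize L ^ s = u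
  generalize Real.exp (-L) = v
  field_simp
  ring

/-- The integrating factor makes the derivative visibly negative, because R - 1 > N. A strictly
decreasing function with a lower bound that tends to 0 at infinity is positive. -/
theorem idleWronskian_pos {s : ℕ} (hs : 1 ≤ s) {L : ℝ} (hL : 0 < L) : 0 < idleWronskian s L := by
  have hanti : StrictAntiOn (idleWronskian s) (Ioi 0) := by
    refine strictAntiOn_of_deriv_neg (convex_Ioi 0)
      (fun x hx => (hasDerivAt_idleWronskian s hx).continuousAt.continuousWithinAt) fun x hx => ?_
    rw [interior_Ioi] at hx
    have hx : 0 < x := hx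
    rw [(hasDerivAt_idleWronskian s hx).deriv, neg_lt_zero]
    have h1 := one_lt_erlangR hs hx
    have h2 := idleRatio_lt_one hs hx
    rw [idleRatio, div_lt_one (by linarith)] at h2
    have h3 := meanIdle_nonneg s hx
    have h4 : 0 < erlangR s x - 1 := by linarith
    have h5 : 0 < erlangR s x - 1 - meanIdle s x := by linarith
    have h6 : 0 < erlangR s x := by linarith
    positivity
  have hlow : ∀ x : ℝ, 0 < x →
      -(x ^ (s + 1) * Real.exp (-x) * (erlangR s x - 1) ^ 2) ≤ idleWronskian s x := by
    intro x hx
    have h1 := one_lt_erlangR hs hx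
    have h3 := meanIdle_nonneg s hx
    have h6 : 0 < erlangR s x := by linarith
    have h7 : x ^ s * Real.exp (-x) / erlangR s x ≤ x ^ s * Real.exp (-x) :=
      div_le_self (by positivity) h1.le
    have h8 : -(x * (erlangR s x - 1) ^ 2) ≤ meanIdle s x ^ 2 * erlangR s x ^ 2 -
      x * (erlangR s x - 1) * (erlangR s x - 1 - meanIdle s x) := by
      have : 0 ≤ x * (erlangR s x - 1) * meanIdle s x := by
        have : 0 ≤ erlangR s x - 1 := by linarith
        positivity
      nlinarith [sq_nonneg (meanIdle s x * erlangR s x)]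
    have h9 : 0 ≤ x * (erlangR s x - 1) ^ 2 := by positivity
    calc -(x ^ (s + 1) * Real.exp (-x) * (erlangR s x - 1) ^ 2)
        = x ^ s * Real.exp (-x) * -(x * (erlangR s x - 1) ^ 2) := by ring
      _ ≤ x ^ s * Real.exp (-x) / erlangR s x * -(x * (erlangR s x - 1) ^ 2) := by nlinarith
      _ ≤ _ := mul_le_mul_of_nonneg_left h8 (by positivity)
  have hlim : Tendsto (fun x : ℝ => -(x ^ (s + 1) * Real.exp (-x) * (erlangR s x - 1) ^ 2))
      atTop (𝓝 0) := by
    have h1 := Real.tendsto_pow_mul_exp_neg_atTop_nhds_zero (s + 1)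
    have h2 := ((tendsto_erlangR_atTop s).sub_const 1).pow 2
    simpa using (h1.mul h2).neg
  have h1 : 0 ≤ idleWronskian s (L + 1) := by
    refine le_of_tendsto hlim ?_
    filter_upwards [eventually_ge_atTop (L + 1)] with x hx
    have hx0 : 0 < x := by linarith
    exact (hlow x hx0).trans (hanti.antitoneOn (show 0 < L + 1 by linarith) hx0 hx)
  exact h1.trans_lt (hanti hL (show 0 < L + 1 by linarith) (by linarith))

theorem idleRatio_strictMonoOn {s : ℕ} (hs : 1 ≤ s) : StrictMonoOn (idleRatio s) (Ioi 0) := by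
  refine strictMonoOn_of_deriv_pos (convex_Ioi 0)
    (fun x hx => (hasDerivAt_idleRatio hs hx).continuousAt.continuousWithinAt) fun x hx => ?_
  rw [interior_Ioi] at hx
  have hx : 0 < x := hx
  rw [(hasDerivAt_idleRatio hs hx).deriv]
  have h1 := one_lt_erlangR hs hx
  have h2 : 0 < erlangR s x - 1 := by linarith
  have h3 : 0 < erlangR s x := by linarith
  have e : idleRatio s x ^ 2 * erlangR s x / x - (1 - idleRatio s x) / erlangR s x =
      idleWronskian s x / (x ^ s * Real.exp (-x) * x * (erlangR s x - 1) ^ 2) := by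
    rw [idleRatio, idleWronskian]
    have := Real.exp_pos (-x)
    field_simp
  rw [e]
  exact div_pos (idleWronskian_pos hs hx) (by positivity)

theorem exists_idleRatio_eq_half {s : ℕ} (hs : 1 ≤ s) : ∃ L > 0, idleRatio s L = 1 / 2 := by
  obtain ⟨b, hb, hb0, h⟩ := exists_half_lt_idleRatio hs (1 / 2)
  have hcont : ContinuousOn (idleRatio s) (Icc (1 / 2) b) := fun L hL =>
    (hasDerivAt_idleRatio hs
      (lt_of_lt_of_le (by norm_num) hL.1)).continuousAt.continuousWithinAt
  obtain ⟨L, hL, e⟩ := intermediate_value_Icc hb.le hcont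
    ⟨idleRatio_le hs (by norm_num), h.le⟩
  exact ⟨L, lt_of_lt_of_le (by norm_num) hL.1, e⟩

/-! ### The Cohen equation and the maximizer in terms of the arrival rate -/

/-- For Λ = s - (γ - a)√s the Cohen equation says a√s = Λ B(s, Λ), that is, N(Λ) = γ√s; injectivity
of N then gives Λ = L. -/
theorem isCohenSol_iff {s : ℕ} (hs : 1 ≤ s) {γ : ℝ} (hγ : γ ∈ Ioo (0 : ℝ) (√(s : ℝ))) {L : ℝ}
    (hL : 0 < L) (hN : meanIdle s L = γ * √(s : ℝ)) (a : ℝ) :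
    IsCohenSol s γ a ↔ a = L / (erlangR s L * √(s : ℝ)) := by
  have hs0 : (0 : ℝ) < s := by exact_mod_cast hs
  set σ := √(s : ℝ) with hσ
  have hσ0 : 0 < σ := Real.sqrt_pos.2 hs0
  have hσ2 : σ * σ = s := Real.mul_self_sqrt hs0.le
  have hr := erlangR_pos s hL
  unfold IsCohenSol fErlang
  rw [← hσ]
  constructor
  · rintro ⟨h1, h2⟩
    set Λ := (s : ℝ) - (γ - a) * σ with hΛ
    have h3 : a * σ = Λ * erlangB s Λ := by
      have : a = (σ - (γ - a)) * erlangB s Λ := by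
        calc a = σ * (1 - (γ - a) / σ) * erlangB s Λ := h2
          _ = _ := by rw [mul_sub, mul_div_cancel₀ _ hσ0.ne', mul_one]
      nth_rewrite 1 [this]
      rw [hΛ, ← hσ2]; ring
    have h4 : 0 ≤ Λ := by rw [hΛ, ← hσ2]; nlinarith
    -- The boundary rate Λ = 0 would force a = 0 and then γ = √s, which is excluded.
    rcases h4.eq_or_lt with h5 | h5
    · rw [← h5, zero_mul] at h3
      have : a = 0 := by
        rcases mul_eq_zero.1 h3 with h | h
        · exact h
        · exact absurd h hσ0.ne'
      rw [this] at hΛ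
      nlinarith [hγ.2]
    · rw [erlangB_eq_inv s h5] at h3
      have h6 : meanIdle s Λ = meanIdle s L := by
        rw [hN, meanIdle, div_eq_mul_inv, ← h3, hΛ]; ring
      have h7 : Λ = L := (meanIdle_strictAntiOn hs).injOn h5 hL h6
      rw [h7] at h3
      field_simp at h3 ⊢
      linarith
  · intro h
    have h1 : a * σ = L / erlangR s L := by rw [h]; field_simp
    have h2 : (s : ℝ) - (γ - a) * σ = L := by
      rw [meanIdle] at hN; linarith
    have h3 : γ - a ≤ σ := by
      by_contra hcon
      push Not at hcon
      nlinarith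
    refine ⟨h3, ?_⟩
    rw [h2, erlangB_eq_inv s hL]
    have h4 : σ * (1 - (γ - a) / σ) = L / σ := by
      rw [← h2, ← hσ2]; field_simp
    rw [h4, h]
    field_simp

theorem exists_rate {s : ℕ} (hs : 1 ≤ s) {γ : ℝ} (hγ : γ ∈ Ioo (0 : ℝ) (√(s : ℝ))) :
    ∃ L > 0, meanIdle s L = γ * √(s : ℝ) := by
  have hs0 : (0 : ℝ) < s := by exact_mod_cast hs
  have hσ0 : 0 < √(s : ℝ) := Real.sqrt_pos.2 hs0
  refine exists_meanIdle_eq hs (mul_pos hγ.1 hσ0) ?_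
  nth_rewrite 2 [← Real.mul_self_sqrt hs0.le]
  exact mul_lt_mul_of_pos_right hγ.2 hσ0

theorem meanIdle_div_sqrt_mem {s : ℕ} (hs : 1 ≤ s) {L : ℝ} (hL : 0 < L) :
    meanIdle s L / √(s : ℝ) ∈ Ioo (0 : ℝ) (√(s : ℝ)) := by
  have hs0 : (0 : ℝ) < s := by exact_mod_cast hs
  have hσ0 : 0 < √(s : ℝ) := Real.sqrt_pos.2 hs0
  refine ⟨div_pos (meanIdle_pos hs hL) hσ0, ?_⟩
  rw [div_lt_iff₀ hσ0, Real.mul_self_sqrt hs0.le]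
  exact meanIdle_lt s hs hL

theorem existsUnique_isCohenSol {s : ℕ} (hs : 1 ≤ s) {γ : ℝ} (hγ : γ ∈ Ioo (0 : ℝ) (√(s : ℝ))) :
    ∃! a : ℝ, IsCohenSol s γ a := by
  obtain ⟨L, hL, hN⟩ := exists_rate hs hγ
  exact ⟨_, (isCohenSol_iff hs hγ hL hN _).2 rfl, fun a ha => (isCohenSol_iff hs hγ hL hN a).1 ha⟩

theorem cohenA_eq {s : ℕ} (hs : 1 ≤ s) {γ : ℝ} (hγ : γ ∈ Ioo (0 : ℝ) (√(s : ℝ))) {L : ℝ}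
    (hL : 0 < L) (hN : meanIdle s L = γ * √(s : ℝ)) :
    cohenA s γ = L / (erlangR s L * √(s : ℝ)) :=
  (isCohenSol_iff hs hγ hL hN _).1 (Classical.epsilon_spec (existsUnique_isCohenSol hs hγ).exists)

/-- The carried traffic `L (1 - B(s, L))²` as a function of the total arrival rate. -/
noncomputable def rateCarried (s : ℕ) (L : ℝ) : ℝ := L * (1 - (erlangR s L)⁻¹) ^ 2

theorem carriedL_eq {s : ℕ} (hs : 1 ≤ s) {γ : ℝ} (hγ : γ ∈ Ioo (0 : ℝ) (√(s : ℝ))) {L : ℝ}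
    (hL : 0 < L) (hN : meanIdle s L = γ * √(s : ℝ)) :
    carriedL s γ = rateCarried s L / √(s : ℝ) := by
  have hs0 : (0 : ℝ) < s := by exact_mod_cast hs
  have hσ0 : 0 < √(s : ℝ) := Real.sqrt_pos.2 hs0
  have hσ2 : √(s : ℝ) * √(s : ℝ) = s := Real.mul_self_sqrt hs0.le
  have hr := erlangR_pos s hL
  have h1 : √(s : ℝ) - γ = L * (1 - (erlangR s L)⁻¹) / √(s : ℝ) := by
    rw [eq_div_iff hσ0.ne', sub_mul, hσ2, ← hN, meanIdle]; ring
  have h2 : L * (1 - (erlangR s L)⁻¹) / √(s : ℝ) + L / (erlangR s L * √(s : ℝ)) =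
      L / √(s : ℝ) := by field_simp; ring
  rw [carriedL, cohenA_eq hs hγ hL hN, h1, h2, rateCarried]
  field_simp

theorem hasDerivAt_rateCarried {s : ℕ} (hs : 1 ≤ s) {L : ℝ} (hL : 0 < L) :
    HasDerivAt (rateCarried s) ((1 - (erlangR s L)⁻¹) ^ 2 * (1 - 2 * idleRatio s L)) L := by
  have hr := one_lt_erlangR hs hL
  have hr0 : erlangR s L ≠ 0 := by linarith
  have hr1 : erlangR s L - 1 ≠ 0 := by linarith
  have hR := hasDerivAt_erlangR s hL
  have e : erlangR s L * (1 - s / L) - 1 = -(erlangR s L * meanIdle s L) / L := by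
    rw [erlangR_mul_meanIdle s hL]; field_simp; ring
  rw [e] at hR
  have h := (hasDerivAt_id L).mul (((hR.inv hr0).const_sub 1).pow 2)
  refine h.congr_deriv ?_
  simp only [id, Pi.pow_apply, Pi.inv_apply, Nat.reduceSub, pow_one, Nat.cast_ofNat]
  rw [idleRatio]
  field_simp
  ring

theorem rateCarried_lt {s : ℕ} (hs : 1 ≤ s) {L₀ L : ℝ} (hL₀ : 0 < L₀) (h : idleRatio s L₀ = 1 / 2)
    (hL : 0 < L) (hne : L ≠ L₀) : rateCarried s L < rateCarried s L₀ := by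
  have hpos : ∀ x : ℝ, 0 < x → 0 < (1 - (erlangR s x)⁻¹) ^ 2 := fun x hx => by
    have := inv_lt_one_of_one_lt₀ (one_lt_erlangR hs hx)
    have : 0 < 1 - (erlangR s x)⁻¹ := by linarith
    positivity
  have hmono := idleRatio_strictMonoOn hs
  rcases lt_or_gt_of_ne hne with hlt | hgt
  · have h1 : StrictMonoOn (rateCarried s) (Icc L L₀) := by
      refine strictMonoOn_of_deriv_pos (convex_Icc _ _) (fun x hx => (hasDerivAt_rateCarried hs
        (hL.trans_le hx.1)).continuousAt.continuousWithinAt) fun x hx => ?_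
      rw [interior_Icc] at hx
      have hx0 : 0 < x := hL.trans hx.1
      rw [(hasDerivAt_rateCarried hs hx0).deriv]
      have := hmono hx0 hL₀ hx.2
      exact mul_pos (hpos x hx0) (by linarith)
    exact h1 ⟨le_rfl, hlt.le⟩ ⟨hlt.le, le_rfl⟩ hlt
  · have h1 : StrictAntiOn (rateCarried s) (Icc L₀ L) := by
      refine strictAntiOn_of_deriv_neg (convex_Icc _ _) (fun x hx => (hasDerivAt_rateCarried hs
        (hL₀.trans_le hx.1)).continuousAt.continuousWithinAt) fun x hx => ?_
      rw [interior_Icc] at hx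
      have hx0 : 0 < x := hL₀.trans hx.1
      rw [(hasDerivAt_rateCarried hs hx0).deriv]
      have := hmono hL₀ hx0 hx.1
      exact mul_neg_of_pos_of_neg (hpos x hx0) (by linarith)
    exact h1 ⟨le_rfl, hgt.le⟩ ⟨hgt.le, le_rfl⟩ hgt

theorem isMaximizerL_iff {s : ℕ} (hs : 1 ≤ s) {L₀ : ℝ} (hL₀ : 0 < L₀)
    (h : idleRatio s L₀ = 1 / 2) (γ : ℝ) :
    IsMaximizerL s γ ↔ γ = meanIdle s L₀ / √(s : ℝ) := by
  have hs0 : (0 : ℝ) < s := by exact_mod_cast hs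
  have hσ0 : 0 < √(s : ℝ) := Real.sqrt_pos.2 hs0
  have hmem := meanIdle_div_sqrt_mem hs hL₀
  have hN₀ : meanIdle s L₀ = meanIdle s L₀ / √(s : ℝ) * √(s : ℝ) := by field_simp
  have e₀ := carriedL_eq hs hmem hL₀ hN₀
  constructor
  · rintro ⟨hγ, hmax⟩
    obtain ⟨L, hL, hN⟩ := exists_rate hs hγ
    have e := carriedL_eq hs hγ hL hN
    by_cases hne : L = L₀
    · rw [← hne, hN]; field_simp
    · have h1 := div_lt_div_of_pos_right (rateCarried_lt hs hL₀ h hL hne) hσ0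
      rw [← e, ← e₀] at h1
      exact absurd (hmax hmem) (not_le.2 h1)
  · rintro rfl
    refine ⟨hmem, fun γ hγ => ?_⟩
    obtain ⟨L, hL, hN⟩ := exists_rate hs hγ
    change carriedL s γ ≤ _
    rw [carriedL_eq hs hγ hL hN, e₀]
    by_cases hne : L = L₀
    · rw [hne]
    · exact (div_lt_div_of_pos_right (rateCarried_lt hs hL₀ h hL hne) hσ0).le

theorem existsUnique_isMaximizerL {s : ℕ} (hs : 1 ≤ s) : ∃! γ : ℝ, IsMaximizerL s γ := by
  obtain ⟨L₀, hL₀, h⟩ := exists_idleRatio_eq_half hs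
  exact ⟨_, (isMaximizerL_iff hs hL₀ h _).2 rfl, fun γ hγ => (isMaximizerL_iff hs hL₀ h γ).1 hγ⟩

theorem isMaximizerL_gammaHat {s : ℕ} (hs : 1 ≤ s) : IsMaximizerL s (gammaHat s) :=
  Classical.epsilon_spec (existsUnique_isMaximizerL hs).exists

theorem gammaHat_mem {s : ℕ} (hs : 1 ≤ s) : gammaHat s ∈ Ioo (0 : ℝ) (√(s : ℝ)) :=
  (isMaximizerL_gammaHat hs).1

/-! ### The critical equation -/

/-- The total arrival rate `(s - c) (1 + 2 c) / (2 c)` at which the maximizer with `c` idle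
servers has to solve the Cohen equation. -/
noncomputable def critRate (s c : ℝ) : ℝ := (s - c) * (1 + 2 * c) / (2 * c)

theorem rate_eq {s : ℕ} (hs : 1 ≤ s) {c L : ℝ} (hL : 0 < L) (hN : meanIdle s L = c) :
    L = (s - c) * (1 + 1 / (erlangR s L - 1)) := by
  have hr := one_lt_erlangR hs hL
  have hr1 : erlangR s L - 1 ≠ 0 := by linarith
  have hr0 : erlangR s L ≠ 0 := by linarith
  rw [← hN, meanIdle]
  field_simp
  ring

theorem critRate_pos {s c : ℝ} (hc : 0 < c) (hcs : c < s) : 0 < critRate s c := by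
  have : 0 < s - c := by linarith
  unfold critRate; positivity

/-- The unknown rate L with N(L) = c is compared with the rate of the maximizer through the idle
ratio, and with the explicit critical rate through L = (s - c)(1 + 1/(R - 1)). Monotonicity of N
then replaces R at L by R at the critical rate, so that no equation has to be solved. -/
theorem compare_gammaHat {s : ℕ} (hs : 1 ≤ s) {γ : ℝ} (hγ : γ ∈ Ioo (0 : ℝ) (√(s : ℝ))) :
    (erlangR s (critRate s (γ * √(s : ℝ))) < 1 + 2 * (γ * √(s : ℝ)) ↔ γ < gammaHat s) ∧
    (1 + 2 * (γ * √(s : ℝ)) < erlangR s (critRate s (γ * √(s : ℝ))) ↔ gammaHat s < γ) := by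
  have hs0 : (0 : ℝ) < s := by exact_mod_cast hs
  have hσ0 : 0 < √(s : ℝ) := Real.sqrt_pos.2 hs0
  obtain ⟨L, hL, hN⟩ := exists_rate hs hγ
  obtain ⟨L₀, hL₀, h₀⟩ := exists_idleRatio_eq_half hs
  have hγ₀ := (isMaximizerL_iff hs hL₀ h₀ _).1 (isMaximizerL_gammaHat hs)
  have hγe : γ = meanIdle s L / √(s : ℝ) := by rw [hN]; field_simp
  set c := γ * √(s : ℝ) with hc
  have hc0 : 0 < c := mul_pos hγ.1 hσ0
  have hcs : c < s := hN ▸ meanIdle_lt s hs hL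
  have hC := critRate_pos hc0 hcs
  have hr := one_lt_erlangR hs hL
  have hrC := one_lt_erlangR hs hC
  have hanti := meanIdle_strictAntiOn hs
  have a1 : γ < gammaHat s ↔ L₀ < L := by
    rw [hγ₀, hγe, div_lt_div_iff_of_pos_right hσ0]
    exact hanti.lt_iff_gt hL hL₀
  have a2 : gammaHat s < γ ↔ L < L₀ := by
    rw [hγ₀, hγe, div_lt_div_iff_of_pos_right hσ0]
    exact hanti.lt_iff_gt hL₀ hL
  have b1 : L₀ < L ↔ erlangR s L < 1 + 2 * c := by
    rw [← (idleRatio_strictMonoOn hs).lt_iff_lt hL₀ hL, h₀, idleRatio, hN,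
      div_lt_div_iff₀ (by norm_num) (by linarith)]
    constructor <;> intro <;> linarith
  have b2 : L < L₀ ↔ 1 + 2 * c < erlangR s L := by
    rw [← (idleRatio_strictMonoOn hs).lt_iff_lt hL hL₀, h₀, idleRatio, hN,
      div_lt_div_iff₀ (by linarith) (by norm_num)]
    constructor <;> intro <;> linarith
  have hLe := rate_eq hs hL hN
  have hCe : critRate s c = (s - c) * (1 + 1 / (2 * c)) := by
    rw [critRate]; field_simp; ring
  have d1 : erlangR s L < 1 + 2 * c ↔ critRate s c < L := by
    rw [hCe]
    nth_rewrite 2 [hLe]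
    rw [mul_lt_mul_iff_of_pos_left (by linarith), add_lt_add_iff_left,
      one_div_lt_one_div (by linarith) (by linarith)]
    constructor <;> intro <;> linarith
  have d2 : 1 + 2 * c < erlangR s L ↔ L < critRate s c := by
    rw [hCe]
    nth_rewrite 2 [hLe]
    rw [mul_lt_mul_iff_of_pos_left (by linarith), add_lt_add_iff_left,
      one_div_lt_one_div (by linarith) (by linarith)]
    constructor <;> intro <;> linarith
  -- This says that replacing R by 1 + 2c in the formula for N at the critical rate gives exactly c.
  have hq : critRate s c / (1 + 2 * c) = critRate s c - (s - c) := by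
    rw [critRate]; field_simp; ring
  have hc1 : 0 < 1 + 2 * c := by linarith
  have hrC0 := erlangR_pos s hC
  have f1 : critRate s c < L ↔ erlangR s (critRate s c) < 1 + 2 * c := by
    rw [← hanti.lt_iff_gt hL hC, hN, meanIdle,
      ← div_lt_div_iff_of_pos_left hC hc1 hrC0, hq]
    constructor <;> intro <;> linarith
  have f2 : L < critRate s c ↔ 1 + 2 * c < erlangR s (critRate s c) := by
    rw [← hanti.lt_iff_gt hC hL, hN, meanIdle,
      ← div_lt_div_iff_of_pos_left hC hrC0 hc1, hq]
    constructor <;> intro <;> linarith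
  exact ⟨by rw [a1, b1, d1, f1], by rw [a2, b2, d2, f2]⟩

theorem erlangR_critRate_gammaHat {s : ℕ} (hs : 1 ≤ s) :
    erlangR s (critRate s (gammaHat s * √(s : ℝ))) = 1 + 2 * (gammaHat s * √(s : ℝ)) := by
  have h := compare_gammaHat hs (gammaHat_mem hs)
  simp only [lt_irrefl, iff_false, not_lt] at h
  exact le_antisymm h.2 h.1

theorem gammaHat_one : gammaHat 1 = 1 / 2 := by
  have hm := gammaHat_mem le_rfl
  have h := erlangR_critRate_gammaHat le_rfl
  simp only [Nat.cast_one, Real.sqrt_one, mul_one, erlangR, critRate] at h hm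
  obtain ⟨h0, h1⟩ := hm
  have h2 : 1 - gammaHat 1 ≠ 0 := by linarith
  have h3 : 1 + 2 * gammaHat 1 ≠ 0 := by linarith
  field_simp at h
  norm_num at h
  have : gammaHat 1 * (1 / 2 - gammaHat 1) = 0 := by nlinarith
  rcases mul_eq_zero.1 this with h | h <;> linarith

/-- The start of the induction: the polynomial inequalities behind the step from s to s + 1 are
proved for γ ≥ 3/5 and s ≥ 2. -/
theorem three_fifths_lt_gammaHat_two : 3 / 5 < gammaHat 2 := by
  have hb1 : (1.4142 : ℝ) < √2 := Real.lt_sqrt_of_sq_lt (by norm_num)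
  have hb2 : √2 < (1.4143 : ℝ) := by
    rw [Real.sqrt_lt' (by norm_num)]; norm_num
  have hm : (3 / 5 : ℝ) ∈ Ioo (0 : ℝ) (√((2 : ℕ) : ℝ)) := by
    push_cast; constructor <;> linarith
  refine (compare_gammaHat (by norm_num) hm).1.1 ?_
  simp only [erlangR]
  push_cast
  have hL : 1.829 < critRate 2 (3 / 5 * √2) := by
    rw [critRate, lt_div_iff₀ (by positivity)]
    nlinarith [Real.mul_self_sqrt (show (0 : ℝ) ≤ 2 by norm_num)]
  generalize critRate 2 (3 / 5 * √2) = L at hL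
  have h1 : 1 / L < 1 / 1.829 := one_div_lt_one_div_of_lt (by norm_num) hL
  have h2 : 0 < 1 / L := by positivity
  have e : 1 + (1 + 1) / L * (1 + (0 + 1) / L * 1) = 1 + 2 * (1 / L) + 2 * (1 / L) ^ 2 := by
    field_simp; ring
  norm_num only at *
  rw [e]
  nlinarith

/-! ### Taylor bound for the reciprocal Erlang B formula -/

/-- First derivative of `erlangR s` at `L`. -/
noncomputable def erlangR₁ (s : ℕ) (L : ℝ) : ℝ := (1 - s / L) * erlangR s L - 1

/-- Second derivative of `erlangR s` at `L`. -/
noncomputable def erlangR₂ (s : ℕ) (L : ℝ) : ℝ :=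
  (1 - s / L) * erlangR₁ s L + s / L ^ 2 * erlangR s L

/-- Third derivative of `erlangR s` at `L`. -/
noncomputable def erlangR₃ (s : ℕ) (L : ℝ) : ℝ :=
  (1 - s / L) * erlangR₂ s L + 2 * (s / L ^ 2) * erlangR₁ s L - 2 * s / L ^ 3 * erlangR s L

theorem erlangR₁_succ (s : ℕ) {L : ℝ} (hL : 0 < L) :
    erlangR₁ (s + 1) L = (s + 1) / L * (erlangR₁ s L - erlangR s L / L) := by
  simp only [erlangR₁, erlangR_succ]
  push_cast
  field_simp
  ring

theorem erlangR₂_succ (s : ℕ) {L : ℝ} (hL : 0 < L) :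
    erlangR₂ (s + 1) L =
      (s + 1) / L * (erlangR₂ s L - 2 * erlangR₁ s L / L + 2 * erlangR s L / L ^ 2) := by
  simp only [erlangR₂, erlangR₁, erlangR_succ]
  push_cast
  field_simp
  ring

theorem erlangR₃_succ (s : ℕ) {L : ℝ} (hL : 0 < L) :
    erlangR₃ (s + 1) L = (s + 1) / L * (erlangR₃ s L - 3 * erlangR₂ s L / L +
      6 * erlangR₁ s L / L ^ 2 - 6 * erlangR s L / L ^ 3) := by
  simp only [erlangR₃, erlangR₂, erlangR₁, erlangR_succ]
  push_cast
  field_simp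
  ring

/-- Each step of the recursion multiplies by a constant over L and adds 1. The factor 1/L has
alternating derivatives and lies above its Taylor polynomials to the left, and both properties pass
to products; so induction on s replaces any remainder formula. -/
theorem erlangR_taylor_aux (s : ℕ) {L h : ℝ} (hL : 0 < L) (h0 : 0 ≤ h) (hh : h < L) :
    erlangR₁ s L ≤ 0 ∧ 0 ≤ erlangR₂ s L ∧ erlangR₃ s L ≤ 0 ∧
      erlangR s L - h * erlangR₁ s L + h ^ 2 / 2 * erlangR₂ s L - h ^ 3 / 6 * erlangR₃ s L ≤
        erlangR s (L - h) := by
  induction s with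
  | zero => simp [erlangR, erlangR₁, erlangR₂, erlangR₃]
  | succ s ih =>
    obtain ⟨i1, i2, i3, i4⟩ := ih
    have i0 := (erlangR_pos s hL).le
    rw [erlangR₁_succ s hL, erlangR₂_succ s hL, erlangR₃_succ s hL, erlangR_succ, erlangR_succ]
    generalize erlangR s (L - h) = y at *
    generalize erlangR s L = r at *
    generalize erlangR₁ s L = r₁ at *
    generalize erlangR₂ s L = r₂ at *
    generalize erlangR₃ s L = r₃ at *
    obtain ⟨a, rfl⟩ : ∃ a, r₁ = -a := ⟨-r₁, by ring⟩
    obtain ⟨b, rfl⟩ : ∃ b, r₃ = -b := ⟨-r₃, by ring⟩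
    have i1 : 0 ≤ a := by linarith
    have i3 : 0 ≤ b := by linarith
    have hk : 0 ≤ ((s : ℝ) + 1) / L := by positivity
    refine ⟨?_, ?_, ?_, ?_⟩
    · refine mul_nonpos_of_nonneg_of_nonpos hk ?_
      have : 0 ≤ r / L := by positivity
      linarith
    · refine mul_nonneg hk ?_
      have : r₂ - 2 * -a / L + 2 * r / L ^ 2 = r₂ + 2 * a / L + 2 * r / L ^ 2 := by ring
      rw [this]; positivity
    · refine mul_nonpos_of_nonneg_of_nonpos hk ?_
      have : -b - 3 * r₂ / L + 6 * -a / L ^ 2 - 6 * r / L ^ 3 =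
        -(b + 3 * r₂ / L + 6 * a / L ^ 2 + 6 * r / L ^ 3) := by ring
      rw [this, neg_nonpos]; positivity
    · obtain ⟨z, rfl⟩ : ∃ z, h = z * L := ⟨h / L, by field_simp⟩
      have hz0 : 0 ≤ z := by
        by_contra hc
        push Not at hc
        nlinarith
      have hz1 : z < 1 := by
        by_contra hc
        push Not at hc
        nlinarith
      have hz : 0 < 1 - z := by linarith
      have e1 : ((s : ℝ) + 1) / (L - z * L) * y = (s + 1) / L * (y / (1 - z)) := by
        have : L - z * L = L * (1 - z) := by ring
        rw [this]; field_simp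
      -- The product of the Taylor polynomial with the geometric series for 1/(1 - z), truncated at
      -- total order three; multiplying back by 1 - z drops only nonnegative terms of order four.
      have e2 : r * (1 + z + z ^ 2 + z ^ 3) + z * L * a * (1 + z + z ^ 2) +
          (z * L) ^ 2 / 2 * r₂ * (1 + z) + (z * L) ^ 3 / 6 * b ≤ y / (1 - z) := by
        rw [le_div_iff₀ hz]
        have : 0 ≤ r * z ^ 4 + z * L * a * z ^ 3 + (z * L) ^ 2 / 2 * r₂ * z ^ 2 +
          (z * L) ^ 3 / 6 * b * z := by positivity
        linarith
      rw [e1]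
      have e3 := mul_le_mul_of_nonneg_left e2 hk
      refine le_trans (le_of_eq ?_) (add_le_add_right e3 1)
      field_simp
      ring

/-- Third order Taylor lower bound for the completely monotone function `erlangR s`. -/
theorem erlangR_taylor (s : ℕ) {L h : ℝ} (hL : 0 < L) (h0 : 0 ≤ h) (hh : h < L) :
    erlangR s L - h * erlangR₁ s L + h ^ 2 / 2 * erlangR₂ s L - h ^ 3 / 6 * erlangR₃ s L ≤
      erlangR s (L - h) :=
  (erlangR_taylor_aux s hL h0 hh).2.2.2

/-! ### Polynomial inequalities for the step from s to s + 1 -/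

/-- The numerator of the Taylor bound, homogenized with respect to `u`. -/
def critPoly (u v w : ℝ) : ℝ :=
  (-16 * u ^ 4 * v ^ 7 + 32 * u ^ 6 * v ^ 5 + 64 * u ^ 8 * v ^ 3) * w ^ 9 +
    (-28 * u ^ 3 * v ^ 8 + 168 * u ^ 5 * v ^ 6 - 48 * u ^ 7 * v ^ 4
      - 96 * u ^ 9 * v ^ 2) * w ^ 8 +
    (-12 * u ^ 2 * v ^ 9 + 160 * u ^ 4 * v ^ 7 - 624 * u ^ 6 * v ^ 5
      + 384 * u ^ 8 * v ^ 3) * w ^ 7 +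
    (-2 * u * v ^ 10 - 4 * u ^ 3 * v ^ 8 - 576 * u ^ 5 * v ^ 6 + 1120 * u ^ 7 * v ^ 4
      - 608 * u ^ 9 * v ^ 2 - 64 * u ^ 11) * w ^ 6 +
    (-2 * v ^ 11 - 24 * u ^ 2 * v ^ 9 - 80 * u ^ 4 * v ^ 7 + 208 * u ^ 6 * v ^ 5
      - 288 * u ^ 8 * v ^ 3 + 192 * u ^ 10 * v) * w ^ 5 +
    (2 * u * v ^ 10 - 4 * u ^ 3 * v ^ 8 - 192 * u ^ 5 * v ^ 6 + 896 * u ^ 7 * v ^ 4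
      - 288 * u ^ 9 * v ^ 2 - 192 * u ^ 11) * w ^ 4 +
    (-4 * v ^ 11 - 4 * u ^ 2 * v ^ 9 + 176 * u ^ 4 * v ^ 7 - 176 * u ^ 6 * v ^ 5
      - 384 * u ^ 8 * v ^ 3 + 384 * u ^ 10 * v) * w ^ 3 +
    (2 * u * v ^ 10 + 108 * u ^ 3 * v ^ 8 - 336 * u ^ 5 * v ^ 6 + 128 * u ^ 7 * v ^ 4
      + 288 * u ^ 9 * v ^ 2 - 192 * u ^ 11) * w ^ 2 +
    (-2 * v ^ 11 + 48 * u ^ 2 * v ^ 9 + 96 * u ^ 4 * v ^ 7 - 368 * u ^ 6 * v ^ 5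
      - 96 * u ^ 8 * v ^ 3 + 192 * u ^ 10 * v) * w +
    (-2 * u * v ^ 10 + 40 * u ^ 3 * v ^ 8 + 8 * u ^ 5 * v ^ 6 + 16 * u ^ 7 * v ^ 4
      + 64 * u ^ 9 * v ^ 2 - 64 * u ^ 11)

/-- After shifting the corner γ = 1, w = 2γ to the origin no negative coefficient remains. -/
theorem critPoly_pos_of_one_le {γ w : ℝ} (hγ : 1 ≤ γ) (hw : 2 * γ ≤ w) : 0 < critPoly γ 1 w := by
  obtain ⟨p, hp, rfl⟩ : ∃ p, 0 ≤ p ∧ γ = 1 + p := ⟨γ - 1, by linarith, by ring⟩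
  obtain ⟨q, hq, rfl⟩ : ∃ q, 0 ≤ q ∧ w = 2 * (1 + p) + q :=
    ⟨w - 2 * (1 + p), by linarith, by ring⟩
  unfold critPoly
  ring_nf
  positivity

/-- As t runs through [0, ∞), the ratio (3/5 + t)/(1 + t) runs through [3/5, 1). By homogeneity this
covers the bounded range of γ, again with coefficients of one sign. -/
theorem critPoly_pos_aux {t q : ℝ} (ht : 0 ≤ t) (hq : 0 ≤ q) :
    0 < critPoly (3 / 5 + t) (1 + t) (3 + q) := by
  unfold critPoly
  ring_nf
  positivity

theorem critPoly_mul (u v w c : ℝ) : critPoly (c * u) (c * v) w = c ^ 11 * critPoly u v w := by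
  unfold critPoly
  ring

theorem critPoly_pos {γ w : ℝ} (hγ : 3 / 5 ≤ γ) (hw : 2 * γ ≤ w) (hw3 : 3 ≤ w) :
    0 < critPoly γ 1 w := by
  rcases le_or_gt 1 γ with h | h
  · exact critPoly_pos_of_one_le h hw
  · have h1 : 0 < 1 - γ := by linarith
    have ht : 0 ≤ (γ - 3 / 5) / (1 - γ) := div_nonneg (by linarith) h1.le
    have key := critPoly_pos_aux ht (show 0 ≤ w - 3 by linarith)
    have e1 : 3 / 5 + (γ - 3 / 5) / (1 - γ) = 2 / 5 / (1 - γ) * γ := by field_simp; ring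
    have e2 : 1 + (γ - 3 / 5) / (1 - γ) = 2 / 5 / (1 - γ) * 1 := by field_simp; ring
    rw [e1, e2, critPoly_mul, add_sub_cancel] at key
    exact pos_of_mul_pos_right key (by positivity)

/-- This is the condition h(1 - s/L) ≤ 1 with denominators cleared, as needed for the Taylor
polynomial to be monotone in the value R. -/
theorem slopePoly_pos {γ w : ℝ} (hγ : 3 / 5 ≤ γ) (hw : 2 * γ ≤ w) (hw3 : 3 ≤ w) :
    0 < 2 * γ ^ 2 * w ^ 5 + 6 * γ ^ 2 * w - 2 * γ * w ^ 2 + 4 * γ ^ 3 * w ^ 2 - 4 * γ ^ 4 * w ^ 3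
      - 4 * γ ^ 4 * w - w ^ 3 - w := by
  rcases le_or_gt 1 γ with h | h
  · obtain ⟨p, hp, rfl⟩ : ∃ p, 0 ≤ p ∧ γ = 1 + p := ⟨γ - 1, by linarith, by ring⟩
    obtain ⟨q, hq, rfl⟩ : ∃ q, 0 ≤ q ∧ w = 2 * (1 + p) + q :=
      ⟨w - 2 * (1 + p), by linarith, by ring⟩
    ring_nf
    positivity
  · have h1 : γ ^ 4 ≤ γ ^ 2 := pow_le_pow_of_le_one (by linarith) h.le (by norm_num)
    have h2 : 9 / 25 ≤ γ ^ 2 := by nlinarith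
    have h3 : 0 ≤ γ ^ 3 * w ^ 2 := by positivity
    have h4 : γ ^ 4 * (w ^ 3 + w) ≤ γ ^ 2 * (w ^ 3 + w) :=
      mul_le_mul_of_nonneg_right h1 (by positivity)
    have h5 : 9 / 25 * (w * (w ^ 2 - 1) ^ 2) ≤ γ ^ 2 * (w * (w ^ 2 - 1) ^ 2) :=
      mul_le_mul_of_nonneg_right h2 (by positivity)
    have h6 : γ * w ^ 2 ≤ 1 * w ^ 2 := mul_le_mul_of_nonneg_right h.le (by positivity)
    have h7 : 8 * (w * (w ^ 2 - 1)) ≤ (w ^ 2 - 1) * (w * (w ^ 2 - 1)) :=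
      mul_le_mul_of_nonneg_right (by nlinarith) (mul_nonneg (by linarith) (by nlinarith))
    have h8 : 9 * w ≤ w ^ 2 * w := mul_le_mul_of_nonneg_right (by nlinarith) (by linarith)
    have h9 : 3 * w ^ 2 ≤ w * w ^ 2 := mul_le_mul_of_nonneg_right hw3 (by positivity)
    nlinarith

/-- The expression is the coefficient of r in `erlangTaylor`. In y = h(1 - s/L) it splits into terms
that are each nonnegative for y ≤ 1. -/
theorem taylor_slope_nonneg {s L h : ℝ} (hs : 0 ≤ s) (hL : 0 < L) (h0 : 0 ≤ h)
    (hy : h * (1 - s / L) ≤ 1) :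
    0 ≤ 1 - h * (1 - s / L) + h ^ 2 / 2 * ((1 - s / L) ^ 2 + s / L ^ 2) -
      h ^ 3 / 6 * ((1 - s / L) ^ 3 + 3 * (1 - s / L) * (s / L ^ 2) - 2 * s / L ^ 3) := by
  have e : 1 - h * (1 - s / L) + h ^ 2 / 2 * ((1 - s / L) ^ 2 + s / L ^ 2) -
      h ^ 3 / 6 * ((1 - s / L) ^ 3 + 3 * (1 - s / L) * (s / L ^ 2) - 2 * s / L ^ 3) =
      (1 - h * (1 - s / L)) + (h * (1 - s / L)) ^ 2 * (1 - h * (1 - s / L) / 3) / 2 +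
        h ^ 2 / 2 * (s / L ^ 2) * (1 - h * (1 - s / L)) + h ^ 3 * s / (3 * L ^ 3) := by
    field_simp; ring
  rw [e]
  generalize h * (1 - s / L) = y at hy
  have h1 : 0 ≤ 1 - y := by linarith
  have h2 : 0 ≤ 1 - y / 3 := by linarith
  positivity

/-- The Taylor polynomial of `erlangR s` at `L`, evaluated at `L - h`, in terms of the value `r`
of `erlangR s L`. -/
noncomputable def erlangTaylor (s L h r : ℝ) : ℝ :=
  r - h * ((1 - s / L) * r - 1) + h ^ 2 / 2 * ((1 - s / L) * ((1 - s / L) * r - 1) + s / L ^ 2 * r)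
    - h ^ 3 / 6 * ((1 - s / L) * ((1 - s / L) * ((1 - s / L) * r - 1) + s / L ^ 2 * r) +
      2 * (s / L ^ 2) * ((1 - s / L) * r - 1) - 2 * s / L ^ 3 * r)

theorem erlangTaylor_le {s L h : ℝ} (hs : 0 ≤ s) (hL : 0 < L) (h0 : 0 ≤ h)
    (hy : h * (1 - s / L) ≤ 1) {r r' : ℝ} (hr : r ≤ r') :
    erlangTaylor s L h r ≤ erlangTaylor s L h r' := by
  have h1 := mul_nonneg (sub_nonneg.2 hr) (taylor_slope_nonneg hs hL h0 hy)
  rw [← sub_nonneg]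
  refine h1.trans_eq ?_
  unfold erlangTaylor
  ring

/-- The Taylor bound exceeds the critical value when the critical equation holds at `L`. -/
theorem taylor_gt_of_eq {γ w D : ℝ} (hγ : 0 < γ) (hw : 0 < w) (hD0 : 0 < D)
    (hD : D = (w ^ 2 + 1 - 2 * w * γ) * (γ * (w ^ 2 + 1) + w)) (hpoly : 0 < critPoly γ 1 w)
    {s L h σ τ : ℝ} (hσ : σ = (w ^ 2 + 1) / (2 * w)) (hτ : τ = (w ^ 2 - 1) / (2 * w))
    (hs : s = τ ^ 2) (hL : L = D / (4 * γ * w ^ 2))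
    (hh : h = (2 * γ * w - 2 * γ ^ 2 + 1) / (2 * γ * w)) :
    1 + 2 * γ * τ < erlangTaylor s L h (2 * γ * L / σ) := by
  unfold erlangTaylor
  generalize hr : 2 * γ * L / σ = r
  generalize h1 : (1 - s / L) * r - 1 = r₁
  generalize h2 : (1 - s / L) * r₁ + s / L ^ 2 * r = r₂
  generalize h3 : (1 - s / L) * r₂ + 2 * (s / L ^ 2) * r₁ - 2 * s / L ^ 3 * r = r₃
  have hS : 0 < w ^ 2 + 1 := by positivity
  have hr' : r = D / (w * (w ^ 2 + 1)) := by
    rw [← hr, hL, hσ]; field_simp; ring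
  have hα : 1 - s / L = (D - γ * (w ^ 2 - 1) ^ 2) / D := by
    rw [hs, hL, hτ]; field_simp; ring
  have hα' : s / L ^ 2 = 4 * w ^ 2 * γ ^ 2 * (w ^ 2 - 1) ^ 2 / D ^ 2 := by
    rw [hs, hL, hτ]; field_simp; ring
  have hα'' : 2 * s / L ^ 3 = 32 * w ^ 4 * γ ^ 3 * (w ^ 2 - 1) ^ 2 / D ^ 3 := by
    rw [hs, hL, hτ]; field_simp; ring
  set E := D - γ * (w ^ 2 - 1) ^ 2 with hE
  set S₁ := (w ^ 2 - 1) ^ 2 with hS₁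
  set A := E - w * (w ^ 2 + 1) with hA
  set B := E * A + 4 * w ^ 2 * γ ^ 2 * S₁ with hB
  set C := E * B + 8 * w ^ 2 * γ ^ 2 * S₁ * A - 32 * w ^ 4 * γ ^ 3 * S₁ with hC
  have h1' : r₁ = A / (w * (w ^ 2 + 1)) := by
    rw [← h1, hα, hr', hA]; field_simp
  have h2' : r₂ = B / (w * (w ^ 2 + 1) * D) := by
    rw [← h2, hα, hα', hr', h1', hB]; field_simp
  have h3' : r₃ = C / (w * (w ^ 2 + 1) * D ^ 2) := by
    rw [← h3, hα, hα', hα'', hr', h2', h1', hC]; field_simp; ring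
  -- `critPoly` at v = 1 is what remains of the numerator of the margin after the factor γw³ is
  -- split off.
  have key : r - h * r₁ + h ^ 2 / 2 * r₂ - h ^ 3 / 6 * r₃ - (1 + 2 * γ * τ) =
      γ * w ^ 3 * critPoly γ 1 w / (48 * γ ^ 3 * w ^ 3 * (w * (w ^ 2 + 1) * D ^ 2)) := by
    have e : γ * w ^ 3 * critPoly γ 1 w =
        48 * γ ^ 3 * w ^ 3 * D ^ 3 -
          24 * γ ^ 2 * w ^ 2 * (2 * γ * w - 2 * γ ^ 2 + 1) * A * D ^ 2 +
          6 * γ * w * (2 * γ * w - 2 * γ ^ 2 + 1) ^ 2 * B * D -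
          (2 * γ * w - 2 * γ ^ 2 + 1) ^ 3 * C -
          48 * γ ^ 3 * w ^ 3 * (w + γ * (w ^ 2 - 1)) * (w ^ 2 + 1) * D ^ 2 := by
      rw [hC, hB, hA, hE, hS₁, hD]; unfold critPoly; ring
    rw [e, hr', h1', h2', h3', hh, hτ]
    clear_value A B C
    field_simp
    ring
  have : 0 < γ * w ^ 3 * critPoly γ 1 w / (48 * γ ^ 3 * w ^ 3 * (w * (w ^ 2 + 1) * D ^ 2)) := by
    positivity
  linarith

theorem critRate_sq {γ σ : ℝ} (hσ : σ ≠ 0) :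
    critRate (σ ^ 2) (γ * σ) = (σ - γ) * (1 + 2 * γ * σ) / (2 * γ) := by
  rw [critRate]
  rcases eq_or_ne γ 0 with rfl | hγ
  · simp
  · field_simp

/-- One step of the recursion turns the hypothesis into R_s(L) ≥ 2γL/√(s+1) at the critical rate L
for s + 1 servers. The Taylor bound moves from L to the critical rate for s servers, and by
monotonicity in r the lower bound may be inserted for R_s(L). -/
theorem lt_erlangR_of_succ_le {s : ℕ} (hs : 2 ≤ s) {γ : ℝ} (hγ : 3 / 5 ≤ γ)
    (hγs : γ < √(s : ℝ))
    (h : 1 + 2 * (γ * √((s + 1 : ℕ) : ℝ)) ≤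
      erlangR (s + 1) (critRate ((s + 1 : ℕ) : ℝ) (γ * √((s + 1 : ℕ) : ℝ)))) :
    1 + 2 * (γ * √(s : ℝ)) < erlangR s (critRate s (γ * √(s : ℝ))) := by
  have hs2 : (2 : ℝ) ≤ s := by exact_mod_cast hs
  set τ := √(s : ℝ) with hτ
  set σ := √((s + 1 : ℕ) : ℝ) with hσ
  have hτ2 : τ ^ 2 = s := Real.sq_sqrt (by linarith)
  have hσ2 : σ ^ 2 = s + 1 := by rw [hσ, Real.sq_sqrt (by positivity)]; push_cast; ring
  have hγ0 : 0 < γ := by linarith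
  have hτ0 : 0 < τ := by linarith
  have hσ0 : 0 < σ := Real.sqrt_pos.2 (by positivity)
  have hστ : τ < σ := by nlinarith
  -- Since σ² - τ² = 1, this sum parametrizes the pair rationally: σ and τ are (w ± 1/w)/2.
  set w := σ + τ with hwdef
  have hw0 : 0 < w := by linarith
  have hw1 : (σ - τ) * w = 1 := by 
    rw [hwdef, show (σ - τ) * (σ + τ) = σ ^ 2 - τ ^ 2 by ring]; linarith
  have hσw : σ = (w ^ 2 + 1) / (2 * w) := by
    rw [eq_div_iff (by positivity)]; nlinarith
  have hτw : τ = (w ^ 2 - 1) / (2 * w) := by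
    rw [eq_div_iff (by positivity)]; nlinarith
  have hw2 : 2 * γ ≤ w := by linarith
  have hw3 : 3 ≤ w := by
    have h1 : (1.41 : ℝ) < τ := by
      by_contra hc
      push Not at hc
      nlinarith
    have h2 : (1.73 : ℝ) < σ := by
      by_contra hc
      push Not at hc
      nlinarith
    linarith
  have hσe : critRate ((s + 1 : ℕ) : ℝ) (γ * σ) = (σ - γ) * (1 + 2 * γ * σ) / (2 * γ) := by
    rw [← critRate_sq hσ0.ne', hσ2]; push_cast; rfl
  have hτe : critRate (s : ℝ) (γ * τ) = (τ - γ) * (1 + 2 * γ * τ) / (2 * γ) := by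
    rw [← critRate_sq hτ0.ne', hτ2]
  rw [hσe] at h
  rw [hτe]
  set L := (σ - γ) * (1 + 2 * γ * σ) / (2 * γ) with hL
  set d := (2 * γ * w - 2 * γ ^ 2 + 1) / (2 * γ * w) with hd
  set D := (w ^ 2 + 1 - 2 * w * γ) * (γ * (w ^ 2 + 1) + w) with hD
  have hD0 : 0 < D := by
    have : 0 < w ^ 2 + 1 - 2 * w * γ := by nlinarith
    positivity
  have hLD : L = D / (4 * γ * w ^ 2) := by
    rw [hL, hσw, hD]; field_simp; ring
  have hL0 : 0 < L := by rw [hLD]; positivity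
  have hd0 : 0 ≤ d := by
    have : 0 ≤ 2 * γ * w - 2 * γ ^ 2 + 1 := by nlinarith
    positivity
  have hL1 : (τ - γ) * (1 + 2 * γ * τ) / (2 * γ) = L - d := by
    rw [hL, hd, hσw, hτw]; field_simp; ring
  have hL1pos : 0 < L - d := by
    rw [← hL1]
    have : 0 < τ - γ := by linarith
    positivity
  rw [hL1]
  refine lt_of_lt_of_le ?_ (erlangR_taylor s hL0 hd0 (by linarith))
  have hy : d * (1 - (s : ℝ) / L) ≤ 1 := by
    have e : d * (1 - (s : ℝ) / L) =
        (2 * γ * w - 2 * γ ^ 2 + 1) * (D - γ * (w ^ 2 - 1) ^ 2) / (2 * γ * w * D) := by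
      rw [hd, ← hτ2, hτw, hLD]; field_simp; ring
    rw [e, div_le_one (by positivity), hD]
    rw [← sub_nonneg]
    exact (slopePoly_pos hγ hw2 hw3).le.trans_eq (by ring)
  have hr : 2 * γ * L / σ ≤ erlangR s L := by
    rw [erlangR_succ] at h
    rw [div_le_iff₀ hσ0]
    have h1 : 2 * (γ * σ) * L ≤ (s + 1) * erlangR s L := by
      have : 2 * (γ * σ) ≤ ((s : ℝ) + 1) * erlangR s L / L := by
        rw [mul_div_right_comm]; linarith
      rwa [le_div_iff₀ hL0] at this
    rw [← hσ2] at h1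
    refine le_of_mul_le_mul_left ?_ hσ0
    linarith
  have hmain := taylor_gt_of_eq hγ0 hw0 hD0 hD (critPoly_pos hγ hw2 hw3) hσw hτw hτ2.symm hLD hd
  rw [← mul_assoc]
  exact hmain.trans_le (erlangTaylor_le (by linarith) hL0 hd0 hy hr)

/-- If the maximizer γ for s were at or above that for s + 1, the comparison at s + 1 would carry
over to a strict inequality at s, where γ satisfies an equality. The bound 3/5 propagates along with
the growth. -/
theorem gammaHat_strictMonoOn : StrictMonoOn gammaHat (Ici 1) := by
  have step : ∀ s : ℕ, 2 ≤ s → 3 / 5 ≤ gammaHat s → gammaHat s < gammaHat (s + 1) := by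
    intro s hs h
    have hm := gammaHat_mem (show 1 ≤ s by omega)
    have hlt : √(s : ℝ) < √((s + 1 : ℕ) : ℝ) :=
      Real.sqrt_lt_sqrt (by positivity) (by push_cast; linarith)
    by_contra hcon
    refine (lt_erlangR_of_succ_le hs h hm.2 ?_).ne' (erlangR_critRate_gammaHat (by omega))
    by_contra hc
    exact hcon ((compare_gammaHat (Nat.le_add_left 1 s) ⟨hm.1, hm.2.trans hlt⟩).1.1
      (not_le.1 hc))
  have hbound : ∀ s : ℕ, 2 ≤ s → 3 / 5 ≤ gammaHat s := by
    intro s hs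
    induction s, hs using Nat.le_induction with
    | base => exact three_fifths_lt_gammaHat_two.le
    | succ s hs ih => exact ih.trans (step s hs ih).le
  have hsucc : ∀ s : ℕ, 1 ≤ s → gammaHat s < gammaHat (s + 1) := by
    intro s hs
    rcases hs.eq_or_lt with rfl | h
    · rw [gammaHat_one]
      exact lt_trans (by norm_num) three_fifths_lt_gammaHat_two
    · exact step s h (hbound s h)
  intro a ha b _ hab
  induction b, (show a + 1 ≤ b from hab) using Nat.le_induction with
  | base => exact hsucc a ha
  | succ b hb ih =>
    have hb1 : 1 ≤ b := le_trans (Nat.le_add_left 1 a) hb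
    exact (ih hb1 hb).trans (hsucc b hb1)

/-! ### Moments and the Mills ratio -/

theorem exp_sub_sq_le (δ u : ℝ) :
    Real.exp (δ * u - u ^ 2 / 2) ≤ Real.exp ((δ + 1) ^ 2 / 2) * Real.exp (-u) := by
  rw [← Real.exp_add, Real.exp_le_exp]
  nlinarith [sq_nonneg (u - (δ + 1))]

theorem integrableOn_pow_mul_exp_neg (k : ℕ) :
    MeasureTheory.IntegrableOn (fun u : ℝ => u ^ k * Real.exp (-u)) (Ioi 0) := by
  have h := Real.GammaIntegral_convergent (s := (k : ℝ) + 1) (by positivity)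
  refine h.congr_fun (fun u _ => ?_) measurableSet_Ioi
  simp only [add_sub_cancel_right, Real.rpow_natCast]
  ring

theorem integrableOn_pow_mul_exp_sub_sq (k : ℕ) (δ : ℝ) :
    MeasureTheory.IntegrableOn (fun u : ℝ => u ^ k * Real.exp (δ * u - u ^ 2 / 2)) (Ioi 0) := by
  refine MeasureTheory.Integrable.mono'
    ((integrableOn_pow_mul_exp_neg k).const_mul (Real.exp ((δ + 1) ^ 2 / 2)))
    (Continuous.aestronglyMeasurable (by fun_prop)) ?_
  filter_upwards [MeasureTheory.ae_restrict_mem measurableSet_Ioi] with u hu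
  have hu : 0 < u := hu
  rw [Real.norm_of_nonneg (by positivity)]
  calc u ^ k * Real.exp (δ * u - u ^ 2 / 2)
      ≤ u ^ k * (Real.exp ((δ + 1) ^ 2 / 2) * Real.exp (-u)) := by
        gcongr; exact exp_sub_sq_le δ u
    _ = _ := by ring

theorem tendsto_pow_mul_exp_sub_sq (k : ℕ) (δ : ℝ) :
    Tendsto (fun u : ℝ => u ^ k * Real.exp (δ * u - u ^ 2 / 2)) atTop (𝓝 0) := by
  have h := (Real.tendsto_pow_mul_exp_neg_atTop_nhds_zero k).const_mul
    (Real.exp ((δ + 1) ^ 2 / 2))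
  rw [mul_zero] at h
  refine squeeze_zero' ?_ ?_ h
  · filter_upwards [eventually_ge_atTop 0] with u hu
    positivity
  · filter_upwards [eventually_ge_atTop 0] with u hu
    calc u ^ k * Real.exp (δ * u - u ^ 2 / 2)
        ≤ u ^ k * (Real.exp ((δ + 1) ^ 2 / 2) * Real.exp (-u)) := by
          gcongr; exact exp_sub_sq_le δ u
      _ = _ := by ring

/-- The moments `∫_0^∞ u^k exp (δ u - u²/2) du`. -/
noncomputable def millsMoment (k : ℕ) (δ : ℝ) : ℝ :=
  ∫ u in Ioi (0 : ℝ), u ^ k * Real.exp (δ * u - u ^ 2 / 2)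

/-- The Mills ratio `Φ(δ)/φ(δ) = ∫_0^∞ exp (δ u - u²/2) du`. -/
noncomputable def millsR (δ : ℝ) : ℝ := millsMoment 0 δ

theorem setIntegral_Ioi_pos {f : ℝ → ℝ} (hf : MeasureTheory.IntegrableOn f (Ioi 0)) (m : ℝ)
    (hpos : ∀ u, 0 < u → u ≠ m → 0 < f u) (hnn : 0 ≤ f m) : 0 < ∫ u in Ioi (0 : ℝ), f u := by
  have hnn' : ∀ u, 0 < u → 0 ≤ f u := fun u hu => by
    rcases eq_or_ne u m with rfl | h
    · exact hnn
    · exact (hpos u hu h).le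
  rw [MeasureTheory.setIntegral_pos_iff_support_of_nonneg_ae _ hf]
  · have hsub : Ioo |m| (|m| + 1) ⊆ Function.support f ∩ Ioi 0 := by
      intro u hu
      have h0 : 0 < u := (abs_nonneg m).trans_lt hu.1
      exact ⟨(hpos u h0 (fun h => by
        have := le_abs_self m
        rw [h] at hu
        linarith [hu.1])).ne', h0⟩
    refine lt_of_lt_of_le ?_ (MeasureTheory.measure_mono hsub)
    simp
  · filter_upwards [MeasureTheory.ae_restrict_mem measurableSet_Ioi] with u hu
    exact hnn' u hu

theorem millsMoment_pos (k : ℕ) (δ : ℝ) : 0 < millsMoment k δ := by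
  refine setIntegral_Ioi_pos (integrableOn_pow_mul_exp_sub_sq k δ) 0 (fun u hu _ => ?_) ?_ <;>
  positivity

theorem hasDerivAt_exp_sub_sq (δ u : ℝ) :
    HasDerivAt (fun u : ℝ => Real.exp (δ * u - u ^ 2 / 2))
      (Real.exp (δ * u - u ^ 2 / 2) * (δ - u)) u := by
  refine HasDerivAt.exp ?_
  refine (((hasDerivAt_id u).const_mul δ).sub
    (((hasDerivAt_id u).pow 2).div_const 2)).congr_deriv ?_
  simp

theorem millsMoment_one (δ : ℝ) : millsMoment 1 δ = 1 + δ * millsR δ := by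
  have h := MeasureTheory.integral_Ioi_of_hasDerivAt_of_tendsto (a := 0) (m := 0)
    (f := fun u : ℝ => Real.exp (δ * u - u ^ 2 / 2))
    (f' := fun u : ℝ => δ * (u ^ 0 * Real.exp (δ * u - u ^ 2 / 2)) -
      u ^ 1 * Real.exp (δ * u - u ^ 2 / 2))
    (hasDerivAt_exp_sub_sq δ 0).continuousAt.continuousWithinAt
    (fun u _ => (hasDerivAt_exp_sub_sq δ u).congr_deriv (by ring))
    (((integrableOn_pow_mul_exp_sub_sq 0 δ).const_mul δ).sub'
      (integrableOn_pow_mul_exp_sub_sq 1 δ))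
    (by simpa using tendsto_pow_mul_exp_sub_sq 0 δ)
  rw [MeasureTheory.integral_sub ((integrableOn_pow_mul_exp_sub_sq 0 δ).const_mul δ)
      (integrableOn_pow_mul_exp_sub_sq 1 δ), MeasureTheory.integral_const_mul] at h
  simp only [mul_zero, ne_eq, OfNat.ofNat_ne_zero, not_false_eq_true, zero_pow, zero_div,
    sub_zero, Real.exp_zero] at h
  rw [millsR]
  unfold millsMoment
  linarith

/-- Integration by parts; every moment thus becomes a polynomial in δ and the Mills ratio, and
positivity of moments yields inequalities for that ratio. -/
theorem millsMoment_add_two (k : ℕ) (δ : ℝ) :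
    millsMoment (k + 2) δ = (k + 1) * millsMoment k δ + δ * millsMoment (k + 1) δ := by
  have i0 := (integrableOn_pow_mul_exp_sub_sq k δ).const_mul (k + 1 : ℝ)
  have i1 := (integrableOn_pow_mul_exp_sub_sq (k + 1) δ).const_mul δ
  have i2 := integrableOn_pow_mul_exp_sub_sq (k + 2) δ
  have hd : ∀ u : ℝ, HasDerivAt (fun u : ℝ => u ^ (k + 1) * Real.exp (δ * u - u ^ 2 / 2))
      ((k + 1 : ℝ) * (u ^ k * Real.exp (δ * u - u ^ 2 / 2)) +
        δ * (u ^ (k + 1) * Real.exp (δ * u - u ^ 2 / 2)) -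
        u ^ (k + 2) * Real.exp (δ * u - u ^ 2 / 2)) u := fun u => by
    refine ((hasDerivAt_pow (k + 1) u).mul (hasDerivAt_exp_sub_sq δ u)).congr_deriv ?_
    push_cast
    ring
  have h := MeasureTheory.integral_Ioi_of_hasDerivAt_of_tendsto (a := 0)
    (hd 0).continuousAt.continuousWithinAt (fun u _ => hd u) ((i0.fun_add i1).sub' i2)
    (tendsto_pow_mul_exp_sub_sq (k + 1) δ)
  rw [MeasureTheory.integral_sub (i0.fun_add i1) i2, MeasureTheory.integral_add i0 i1,
    MeasureTheory.integral_const_mul, MeasureTheory.integral_const_mul] at h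
  simp only [ne_eq, Nat.add_eq_zero_iff, one_ne_zero, and_false, not_false_eq_true, zero_pow,
    zero_mul, sub_zero] at h
  unfold millsMoment
  linarith

/-- Integrate (u - m)² against the weight, with m the mean of the truncated normal law. -/
theorem millsMoment_variance_pos (δ : ℝ) :
    0 < millsMoment 2 δ * millsR δ - millsMoment 1 δ ^ 2 := by
  have h0 : 0 < millsR δ := millsMoment_pos 0 δ
  set m := millsMoment 1 δ / millsR δ with hm
  have i0 := (integrableOn_pow_mul_exp_sub_sq 0 δ).const_mul (m ^ 2)
  have i1 := (integrableOn_pow_mul_exp_sub_sq 1 δ).const_mul (2 * m)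
  have i2 := integrableOn_pow_mul_exp_sub_sq 2 δ
  have h : 0 < ∫ u in Ioi (0 : ℝ), (u ^ 2 * Real.exp (δ * u - u ^ 2 / 2) -
      2 * m * (u ^ 1 * Real.exp (δ * u - u ^ 2 / 2)) +
      m ^ 2 * (u ^ 0 * Real.exp (δ * u - u ^ 2 / 2))) := by
    have e : ∀ u : ℝ, u ^ 2 * Real.exp (δ * u - u ^ 2 / 2) -
        2 * m * (u ^ 1 * Real.exp (δ * u - u ^ 2 / 2)) +
        m ^ 2 * (u ^ 0 * Real.exp (δ * u - u ^ 2 / 2)) =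
        (u - m) ^ 2 * Real.exp (δ * u - u ^ 2 / 2) := fun u => by ring
    refine setIntegral_Ioi_pos ((MeasureTheory.Integrable.sub' i2 i1).fun_add i0) m
      (fun u hu hne => ?_) ?_
    · rw [e]
      have : u - m ≠ 0 := sub_ne_zero.2 hne
      positivity
    · rw [e]; positivity
  rw [MeasureTheory.integral_add (MeasureTheory.Integrable.sub' i2 i1) i0,
    MeasureTheory.integral_sub i2 i1,
    MeasureTheory.integral_const_mul, MeasureTheory.integral_const_mul] at h
  change 0 < millsMoment 2 δ - 2 * m * millsMoment 1 δ + m ^ 2 * millsR δ at h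
  have e : (millsMoment 2 δ - 2 * m * millsMoment 1 δ + m ^ 2 * millsR δ) * millsR δ =
      millsMoment 2 δ * millsR δ - millsMoment 1 δ ^ 2 := by
    rw [hm]; field_simp; ring
  rw [← e]
  positivity

theorem integral_Iic_exp_eq (δ : ℝ) :
    ∫ t in Iic δ, Real.exp (-t ^ 2 / 2) = Real.exp (-δ ^ 2 / 2) * millsR δ := by
  have h1 : ∫ t in Iic δ, Real.exp (-t ^ 2 / 2) =
      ∫ u in Ioi (0 : ℝ), Real.exp (-(δ - u) ^ 2 / 2) := by
    rw [← MeasureTheory.integral_Ici_eq_integral_Ioi, ← MeasureTheory.integral_indicator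
      measurableSet_Iic, ← MeasureTheory.integral_indicator measurableSet_Ici,
      ← MeasureTheory.integral_sub_left_eq_self _ MeasureTheory.volume δ]
    congr 1
    ext u
    simp only [indicator, mem_Iic, mem_Ici, sub_le_self_iff]
  rw [h1, millsR, millsMoment, ← MeasureTheory.integral_const_mul]
  congr 1
  ext u
  rw [pow_zero, one_mul, ← Real.exp_add]
  congr 1
  ring

theorem integrable_exp_neg_sq_div_two :
    MeasureTheory.Integrable (fun t : ℝ => Real.exp (-t ^ 2 / 2)) := by
  have h := integrable_exp_neg_mul_sq (b := 1 / 2) (by norm_num)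
  refine h.congr (MeasureTheory.ae_of_all _ fun t => ?_)
  simp only
  congr 1
  ring

theorem hasDerivAt_millsR (δ : ℝ) : HasDerivAt millsR (1 + δ * millsR δ) δ := by
  have hc : Continuous (fun t : ℝ => Real.exp (-t ^ 2 / 2)) := by fun_prop
  have h1 : HasDerivAt (fun x : ℝ => ∫ t in Iic x, Real.exp (-t ^ 2 / 2))
      (Real.exp (-δ ^ 2 / 2)) δ := by
    have h := (intervalIntegral.integral_hasDerivAt_right (hc.intervalIntegrable 0 δ)
      (hc.stronglyMeasurableAtFilter _ _) hc.continuousAt).const_add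
      (∫ t in Iic (0 : ℝ), Real.exp (-t ^ 2 / 2))
    refine h.congr_of_eventuallyEq (Eventually.of_forall fun x => ?_)
    simp only
    rw [← intervalIntegral.integral_Iic_sub_Iic integrable_exp_neg_sq_div_two.integrableOn
      integrable_exp_neg_sq_div_two.integrableOn]
    ring
  have h2 : HasDerivAt (fun x : ℝ => Real.exp (x ^ 2 / 2)) (Real.exp (δ ^ 2 / 2) * δ) δ := by
    refine HasDerivAt.exp (((hasDerivAt_pow 2 δ).div_const 2).congr_deriv ?_)
    simp
  have e : ∀ x : ℝ, millsR x = Real.exp (x ^ 2 / 2) * ∫ t in Iic x, Real.exp (-t ^ 2 / 2) := by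
    intro x
    rw [integral_Iic_exp_eq, ← mul_assoc, ← Real.exp_add]
    ring_nf
    simp
  refine ((h2.mul h1).congr_of_eventuallyEq (Eventually.of_forall e)).congr_deriv ?_
  have h3 : Real.exp (δ ^ 2 / 2) * Real.exp (-δ ^ 2 / 2) = 1 := by
    rw [← Real.exp_add]; ring_nf; simp
  rw [e δ, h3]
  ring

theorem millsR_zero : millsR 0 = √(Real.pi / 2) := by
  have h := integral_gaussian_Ioi (1 / 2)
  have e : millsR 0 = ∫ x in Ioi (0 : ℝ), Real.exp (-(1 / 2) * x ^ 2) := by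
    rw [millsR, millsMoment]
    congr 1
    ext u
    ring_nf
  rw [e, h]
  have : Real.pi / (1 / 2) = Real.pi / 2 * 2 ^ 2 := by ring
  rw [this, Real.sqrt_mul (by positivity), Real.sqrt_sq (by norm_num)]
  ring

theorem fInfty_eq (δ : ℝ) : fInfty δ = (millsR δ)⁻¹ := by
  have h0 : 0 < millsR δ := millsMoment_pos 0 δ
  have h1 : ProbabilityTheory.cdf (ProbabilityTheory.gaussianReal 0 1) δ =
      ∫ x in Iic δ, ProbabilityTheory.gaussianPDFReal 0 1 x := by
    rw [ProbabilityTheory.cdf_eq_real, MeasureTheory.measureReal_def,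
      ProbabilityTheory.gaussianReal_apply_eq_integral 0 one_ne_zero, ENNReal.toReal_ofReal]
    exact MeasureTheory.integral_nonneg fun x => ProbabilityTheory.gaussianPDFReal_nonneg 0 1 x
  have h2 : ∀ x : ℝ, ProbabilityTheory.gaussianPDFReal 0 1 x =
      (√(2 * Real.pi))⁻¹ * Real.exp (-x ^ 2 / 2) := fun x => by
    simp [ProbabilityTheory.gaussianPDFReal]
  rw [fInfty, h1]
  simp only [h2]
  rw [MeasureTheory.integral_const_mul, integral_Iic_exp_eq]
  have : 0 < √(2 * Real.pi) := by positivity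
  field_simp

theorem millsR_pos (δ : ℝ) : 0 < millsR δ := millsMoment_pos 0 δ

theorem one_add_mul_millsR_pos (δ : ℝ) : 0 < 1 + δ * millsR δ := by
  rw [← millsMoment_one]; exact millsMoment_pos 1 δ

theorem one_add_mul_millsR_lt_sq (δ : ℝ) : 1 + δ * millsR δ < millsR δ ^ 2 := by
  have h := millsMoment_variance_pos δ
  have h2 := millsMoment_add_two 0 δ
  rw [zero_add, zero_add, millsMoment_one, show millsMoment 0 δ = millsR δ from rfl] at h2
  rw [h2, millsMoment_one] at h
  push_cast at h
  nlinarith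

theorem millsR_add_mul_pos (δ : ℝ) : 0 < millsR δ + δ * (1 + δ * millsR δ) := by
  have h2 := millsMoment_add_two 0 δ
  rw [zero_add, zero_add, millsMoment_one, show millsMoment 0 δ = millsR δ from rfl] at h2
  have := millsMoment_pos 2 δ
  push_cast at h2
  linarith

theorem millsR_third_pos (δ : ℝ) :
    0 < 2 * (1 + δ * millsR δ) + δ * (millsR δ + δ * (1 + δ * millsR δ)) := by
  have h2 := millsMoment_add_two 0 δ
  have h3 := millsMoment_add_two 1 δ
  rw [zero_add, zero_add, millsMoment_one, show millsMoment 0 δ = millsR δ from rfl] at h2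
  norm_num at h2 h3
  rw [h2, millsMoment_one] at h3
  have := millsMoment_pos 3 δ
  linarith

/-! ### The truncated normal distribution and the limiting Cohen equation -/

/-- The mean `δ + φ(δ)/Φ(δ)` of the normal distribution with mean `δ`, truncated to `(0, ∞)`. -/
noncomputable def truncMean (δ : ℝ) : ℝ := δ + fInfty δ

theorem truncMean_eq (δ : ℝ) : truncMean δ = (1 + δ * millsR δ) / millsR δ := by
  have := millsR_pos δ
  rw [truncMean, fInfty_eq]; field_simp; ring

theorem fInfty_pos (δ : ℝ) : 0 < fInfty δ := by
  rw [fInfty_eq]; exact inv_pos.2 (millsR_pos δ)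

theorem truncMean_pos (δ : ℝ) : 0 < truncMean δ := by
  rw [truncMean_eq]; exact div_pos (one_add_mul_millsR_pos δ) (millsR_pos δ)

theorem hasDerivAt_fInfty (δ : ℝ) : HasDerivAt fInfty (-(fInfty δ * truncMean δ)) δ := by
  have h0 := millsR_pos δ
  have h := (hasDerivAt_millsR δ).inv h0.ne'
  refine (h.congr_of_eventuallyEq (Eventually.of_forall fInfty_eq)).congr_deriv ?_
  rw [fInfty_eq, truncMean_eq]; field_simp

theorem hasDerivAt_truncMean (δ : ℝ) :
    HasDerivAt truncMean (1 - fInfty δ * truncMean δ) δ :=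
  ((hasDerivAt_id δ).add (hasDerivAt_fInfty δ)).congr_deriv (by ring)

/-- One minus the variance of the truncated normal distribution. -/
noncomputable def truncGap (δ : ℝ) : ℝ := truncMean δ * fInfty δ

theorem truncGap_lt_one (δ : ℝ) : truncGap δ < 1 := by
  have h := one_add_mul_millsR_lt_sq δ
  have h0 := millsR_pos δ
  rw [truncGap, truncMean_eq, fInfty_eq, ← div_eq_mul_inv, div_div, div_lt_one (by positivity)]
  nlinarith

theorem truncMean_strictMono : StrictMono truncMean := by
  refine strictMono_of_deriv_pos fun δ => ?_
  rw [(hasDerivAt_truncMean δ).deriv]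
  have := truncGap_lt_one δ
  rw [truncGap] at this
  linarith

theorem one_add_mul_truncMean_pos (δ : ℝ) : 0 < 1 + δ * truncMean δ := by
  have h0 := millsR_pos δ
  have : 1 + δ * truncMean δ = (millsR δ + δ * (1 + δ * millsR δ)) / millsR δ := by
    rw [truncMean_eq]; field_simp
  rw [this]
  exact div_pos (millsR_add_mul_pos δ) h0

/-- The bracket [-1/γ, γ] works: positivity of the second moment bounds the mean by γ at the left
end, and positivity of φ/Φ bounds it from below at the right end. -/
theorem exists_truncMean_eq {γ : ℝ} (hγ : 0 < γ) : ∃ δ, truncMean δ = γ := by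
  have h1 : truncMean (-(1 / γ)) ≤ γ := by
    have h := one_add_mul_truncMean_pos (-(1 / γ))
    have e : 1 + -(1 / γ) * truncMean (-(1 / γ)) = (γ - truncMean (-(1 / γ))) / γ := by
      field_simp; ring
    rw [e] at h
    have := (div_pos_iff_of_pos_right hγ).1 h
    linarith
  have h2 : γ ≤ truncMean γ := by
    have := fInfty_pos γ
    rw [truncMean]; linarith
  have hle : -(1 / γ) ≤ γ := by
    have : 0 < 1 / γ := by positivity
    linarith
  obtain ⟨δ, _, h⟩ := intermediate_value_Icc hle
    (fun x _ => (hasDerivAt_truncMean x).continuousAt.continuousWithinAt) ⟨h1, h2⟩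
  exact ⟨δ, h⟩

theorem existsUnique_cohenInfty {γ : ℝ} (hγ : 0 < γ) : ∃! a : ℝ, a = fInfty (γ - a) := by
  obtain ⟨δ, hδ⟩ := exists_truncMean_eq hγ
  refine ⟨γ - δ, ?_, fun a ha => ?_⟩
  · simp only [sub_sub_cancel]
    rw [← hδ, truncMean]; ring
  · have : truncMean (γ - a) = truncMean δ := by
      rw [hδ, truncMean, ← ha]; ring
    have := truncMean_strictMono.injective this
    linarith

theorem cohenAInfty_eq {γ : ℝ} (hγ : 0 < γ) : cohenAInfty γ = fInfty (γ - cohenAInfty γ) :=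
  Classical.epsilon_spec (existsUnique_cohenInfty hγ).exists

theorem truncMean_sub_cohenAInfty {γ : ℝ} (hγ : 0 < γ) :
    truncMean (γ - cohenAInfty γ) = γ := by
  rw [truncMean, ← cohenAInfty_eq hγ]; ring

theorem mul_cohenAInfty_eq {γ : ℝ} (hγ : 0 < γ) :
    γ * cohenAInfty γ = truncGap (γ - cohenAInfty γ) := by
  rw [truncGap, truncMean_sub_cohenAInfty hγ, ← cohenAInfty_eq hγ]

theorem hasDerivAt_exp_neg_sq (x : ℝ) :
    HasDerivAt (fun x : ℝ => Real.exp (-x ^ 2 / 2)) (Real.exp (-x ^ 2 / 2) * -x) x :=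
  HasDerivAt.exp (((hasDerivAt_pow 2 x).neg.div_const 2).congr_deriv (by push_cast; ring))

theorem exp_sq_mul_exp_neg_sq (x : ℝ) : Real.exp (x ^ 2 / 2) * Real.exp (-x ^ 2 / 2) = 1 := by
  rw [← Real.exp_add, show x ^ 2 / 2 + -x ^ 2 / 2 = 0 by ring, Real.exp_zero]

/-- A multiple of the third cumulant of the truncated normal distribution. -/
noncomputable def truncSkew (δ : ℝ) : ℝ :=
  Real.exp (-δ ^ 2 / 2) *
    (millsR δ * ((1 + δ * millsR δ) ^ 2 + (1 + δ * millsR δ) - millsR δ ^ 2))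

theorem hasDerivAt_truncSkew (δ : ℝ) :
    HasDerivAt truncSkew (Real.exp (-δ ^ 2 / 2) * (2 * (1 + δ * millsR δ) ^ 3)) δ := by
  have hR := hasDerivAt_millsR δ
  have hM := ((hasDerivAt_id δ).mul hR).const_add 1
  refine ((hasDerivAt_exp_neg_sq δ).mul
    (hR.mul (((hM.pow 2).add hM).sub (hR.pow 2)))).congr_deriv ?_
  simp only [Pi.mul_apply, Pi.add_apply, Pi.sub_apply, Pi.pow_apply, id]
  push_cast
  ring

/-- The Gaussian factor makes the derivative a positive multiple of the cube of the first moment.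
The function therefore increases, and a lower bound tending to 0 at -∞ makes it positive. -/
theorem truncSkew_pos (δ : ℝ) : 0 < truncSkew δ := by
  have hmono : StrictMono truncSkew := strictMono_of_deriv_pos fun x => by
    rw [(hasDerivAt_truncSkew x).deriv]
    have := one_add_mul_millsR_pos x
    positivity
  have hlow : ∀ x : ℝ, x ≤ -2 → -Real.exp x ≤ truncSkew x := by
    intro x hx
    have h0 := millsR_pos x
    have h1 := one_add_mul_millsR_pos x
    have h2 : millsR x ≤ 1 := by nlinarith
    have h3 : Real.exp (-x ^ 2 / 2) ≤ Real.exp x := Real.exp_le_exp.2 (by nlinarith)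
    have h4 : -(1 : ℝ) ≤
        millsR x * ((1 + x * millsR x) ^ 2 + (1 + x * millsR x) - millsR x ^ 2) := by
      have : millsR x ^ 3 ≤ 1 := pow_le_one₀ h0.le h2
      have : 0 < millsR x * ((1 + x * millsR x) ^ 2 + (1 + x * millsR x)) := by positivity
      nlinarith
    have h5 := mul_le_mul_of_nonneg_left h4 (Real.exp_pos (-x ^ 2 / 2)).le
    rw [truncSkew]
    linarith
  have hlim : Tendsto (fun x : ℝ => -Real.exp x) atBot (𝓝 0) := by
    simpa using Real.tendsto_exp_atBot.neg
  have h1 : 0 ≤ truncSkew (δ - 1) := by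
    refine le_of_tendsto hlim ?_
    filter_upwards [eventually_le_atBot (δ - 1), eventually_le_atBot (-2)] with x hx hx1
    exact (hlow x hx1).trans (hmono.monotone hx)
  exact h1.trans_lt (hmono (by linarith))

/-- The derivative of the variance with respect to δ is the third cumulant. -/
theorem truncGap_strictAnti : StrictAnti truncGap := by
  refine strictAnti_of_deriv_neg fun δ => ?_
  have h0 := millsR_pos δ
  have hd : HasDerivAt truncGap _ δ := (hasDerivAt_truncMean δ).mul (hasDerivAt_fInfty δ)
  rw [hd.deriv]
  have e : (1 - fInfty δ * truncMean δ) * fInfty δ +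
      truncMean δ * -(fInfty δ * truncMean δ) =
      -(truncSkew δ / (Real.exp (-δ ^ 2 / 2) * millsR δ ^ 4)) := by
    rw [truncSkew, truncMean_eq, fInfty_eq]
    field_simp
    ring
  rw [e, neg_lt_zero]
  exact div_pos (truncSkew_pos δ) (by positivity)

theorem sub_cohenAInfty_strictMonoOn : StrictMonoOn (fun γ => γ - cohenAInfty γ) (Ioi 0) := by
  intro x hx y hy hxy
  refine truncMean_strictMono.lt_iff_lt.1 ?_
  simpa only [truncMean_sub_cohenAInfty hx, truncMean_sub_cohenAInfty hy] using hxy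

theorem mul_cohenAInfty_strictAntiOn :
    StrictAntiOn (fun γ : ℝ => γ * cohenAInfty γ) (Ioi 0) := by
  intro x hx y hy hxy
  simp only
  rw [mul_cohenAInfty_eq hx, mul_cohenAInfty_eq hy]
  exact truncGap_strictAnti (sub_cohenAInfty_strictMonoOn hx hy hxy)

/-! ### Comparison for the Mills ratio and the limits of γ a_∞(γ) -/

theorem hasDerivAt_exp_mul_millsR_sub {U U' : ℝ → ℝ} (hU : ∀ x, HasDerivAt U (U' x) x) (x : ℝ) :
    HasDerivAt (fun x => Real.exp (-x ^ 2 / 2) * (millsR x - U x))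
      (Real.exp (-x ^ 2 / 2) * (1 + x * U x - U' x)) x := by
  refine ((hasDerivAt_exp_neg_sq x).mul ((hasDerivAt_millsR x).sub (hU x))).congr_deriv ?_
  simp only [Pi.sub_apply]
  ring

/-- Comparison principle for the linear differential equation `R' = 1 + x R`. -/
theorem le_millsR {U U' : ℝ → ℝ} {δ : ℝ} (hδ : 0 ≤ δ) (hU : ∀ x, HasDerivAt U (U' x) x)
    (h0 : U 0 = 0) (h : ∀ x, 0 < x → x < δ → U' x ≤ 1 + x * U x) :
    Real.exp (δ ^ 2 / 2) * millsR 0 + U δ ≤ millsR δ := by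
  have hV := hasDerivAt_exp_mul_millsR_sub hU
  have hmono : MonotoneOn (fun x => Real.exp (-x ^ 2 / 2) * (millsR x - U x)) (Icc 0 δ) := by
    refine monotoneOn_of_deriv_nonneg (convex_Icc 0 δ)
      (fun x _ => (hV x).continuousAt.continuousWithinAt)
      (fun x _ => (hV x).differentiableAt.differentiableWithinAt) fun x hx => ?_
    rw [interior_Icc] at hx
    rw [(hV x).deriv]
    have := h x hx.1 hx.2
    exact mul_nonneg (Real.exp_pos _).le (by linarith)
  have key := hmono ⟨le_rfl, hδ⟩ ⟨hδ, le_rfl⟩ hδ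
  simp only [ne_eq, OfNat.ofNat_ne_zero, not_false_eq_true, zero_pow, neg_zero, zero_div,
    Real.exp_zero, one_mul, h0, sub_zero] at key
  have := mul_le_mul_of_nonneg_left key (Real.exp_pos (δ ^ 2 / 2)).le
  rw [← mul_assoc, exp_sq_mul_exp_neg_sq] at this
  linarith

/-- Comparison principle for the linear differential equation `R' = 1 + x R`. -/
theorem millsR_le {U U' : ℝ → ℝ} {δ : ℝ} (hδ : 0 ≤ δ) (hU : ∀ x, HasDerivAt U (U' x) x)
    (h0 : U 0 = 0) (h : ∀ x, 0 < x → x < δ → 1 + x * U x ≤ U' x) :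
    millsR δ ≤ Real.exp (δ ^ 2 / 2) * millsR 0 + U δ := by
  have hV := hasDerivAt_exp_mul_millsR_sub hU
  have hanti : AntitoneOn (fun x => Real.exp (-x ^ 2 / 2) * (millsR x - U x)) (Icc 0 δ) := by
    refine antitoneOn_of_deriv_nonpos (convex_Icc 0 δ)
      (fun x _ => (hV x).continuousAt.continuousWithinAt)
      (fun x _ => (hV x).differentiableAt.differentiableWithinAt) fun x hx => ?_
    rw [interior_Icc] at hx
    rw [(hV x).deriv]
    have := h x hx.1 hx.2
    exact mul_nonpos_of_nonneg_of_nonpos (Real.exp_pos _).le (by linarith)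
  have key := hanti ⟨le_rfl, hδ⟩ ⟨hδ, le_rfl⟩ hδ
  simp only [ne_eq, OfNat.ofNat_ne_zero, not_false_eq_true, zero_pow, neg_zero, zero_div,
    Real.exp_zero, one_mul, h0, sub_zero] at key
  have := mul_le_mul_of_nonneg_left key (Real.exp_pos (δ ^ 2 / 2)).le
  rw [← mul_assoc, exp_sq_mul_exp_neg_sq] at this
  linarith

theorem tendsto_truncGap_atBot : Tendsto truncGap atBot (𝓝 1) := by
  have hlim : Tendsto (fun δ : ℝ => 1 - 2 / (2 + δ ^ 2)) atBot (𝓝 1) := by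
    have : Tendsto (fun δ : ℝ => 2 + δ ^ 2) atBot atTop :=
      tendsto_atTop_add_const_left _ _ (by
        simpa [Function.comp_def] using
          (tendsto_pow_atTop two_ne_zero).comp (tendsto_abs_atBot_atTop (G := ℝ)))
    simpa using (tendsto_const_nhds.div_atTop this).const_sub 1
  refine tendsto_of_tendsto_of_tendsto_of_le_of_le' hlim tendsto_const_nhds ?_
    (Eventually.of_forall fun δ => (truncGap_lt_one δ).le)
  filter_upwards [eventually_le_atBot 0] with δ hδ
  have h0 := millsR_pos δ
  have h1 := millsR_third_pos δ
  -- Positivity of the third moment; for δ ≤ 0 it bounds the mean below by -δ/(2 + δ²), and φ/Φ ≥ -δ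
  -- supplies the other factor.
  have h2 : 0 < (2 + δ ^ 2) * truncMean δ + δ := by
    have : (2 + δ ^ 2) * truncMean δ + δ =
      (2 * (1 + δ * millsR δ) + δ * (millsR δ + δ * (1 + δ * millsR δ))) / millsR δ := by
      rw [truncMean_eq]; field_simp; ring
    rw [this]; positivity
  have h3 := truncMean_pos δ
  have h4 : -δ ≤ fInfty δ := by rw [truncMean] at h3; linarith
  have h5 : 1 - 2 / (2 + δ ^ 2) = δ ^ 2 / (2 + δ ^ 2) := by field_simp; ring
  rw [h5, div_le_iff₀ (by positivity), truncGap]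
  nlinarith [mul_le_mul_of_nonneg_left h4 h3.le]

theorem tendsto_truncGap_atTop : Tendsto truncGap atTop (𝓝 0) := by
  have hlim : Tendsto (fun δ : ℝ => 6 / δ) atTop (𝓝 0) :=
    tendsto_const_nhds.div_atTop tendsto_id
  refine squeeze_zero' (Eventually.of_forall fun δ =>
    (mul_pos (truncMean_pos δ) (fInfty_pos δ)).le) ?_ hlim
  filter_upwards [eventually_ge_atTop 1] with δ hδ
  have h1 := le_millsR (U := fun _ => 0) (U' := fun _ => 0) (δ := δ) (by linarith)
    (fun x => hasDerivAt_const x 0) rfl (fun x _ _ => by simp)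
  have h2 : 1 ≤ millsR 0 := by
    rw [millsR_zero]
    exact Real.one_le_sqrt.2 (by linarith [Real.pi_gt_three])
  have h3 := Real.add_one_le_exp (δ ^ 2 / 2)
  have h4 : δ ^ 2 / 2 ≤ millsR δ := by nlinarith
  have h5 : fInfty δ ≤ 2 / δ ^ 2 := by
    rw [fInfty_eq, inv_le_comm₀ (millsR_pos δ) (by positivity), inv_div]
    exact h4
  have h6 : 2 / δ ^ 2 ≤ 2 := by
    rw [div_le_iff₀ (by positivity)]; nlinarith
  have h7 := fInfty_pos δ
  calc truncGap δ ≤ (3 * δ) * (2 / δ ^ 2) := by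
        rw [truncGap, truncMean]
        exact mul_le_mul (by linarith) h5 h7.le (by linarith)
    _ = 6 / δ := by field_simp; norm_num

theorem tendsto_sub_cohenAInfty_zero :
    Tendsto (fun γ => γ - cohenAInfty γ) (𝓝[>] 0) atBot := by
  refine tendsto_atBot.2 fun b => ?_
  filter_upwards [Ioo_mem_nhdsGT (truncMean_pos b)] with γ hγ
  refine (truncMean_strictMono.lt_iff_lt.1 ?_).le
  rw [truncMean_sub_cohenAInfty hγ.1]
  exact hγ.2

theorem tendsto_sub_cohenAInfty_atTop :
    Tendsto (fun γ => γ - cohenAInfty γ) atTop atTop := by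
  refine tendsto_atTop.2 fun b => ?_
  filter_upwards [eventually_gt_atTop (truncMean b), eventually_gt_atTop 0] with γ hγ h0
  refine (truncMean_strictMono.lt_iff_lt.1 ?_).le
  rw [truncMean_sub_cohenAInfty h0]
  exact hγ

theorem tendsto_mul_cohenAInfty_zero :
    Tendsto (fun γ : ℝ => γ * cohenAInfty γ) (𝓝[>] 0) (𝓝 1) := by
  refine (tendsto_truncGap_atBot.comp tendsto_sub_cohenAInfty_zero).congr' ?_
  filter_upwards [self_mem_nhdsWithin] with γ hγ
  exact (mul_cohenAInfty_eq hγ).symm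

theorem tendsto_mul_cohenAInfty_atTop :
    Tendsto (fun γ : ℝ => γ * cohenAInfty γ) atTop (𝓝 0) := by
  refine (tendsto_truncGap_atTop.comp tendsto_sub_cohenAInfty_atTop).congr' ?_
  filter_upwards [eventually_gt_atTop 0] with γ hγ
  exact (mul_cohenAInfty_eq hγ).symm

/-! ### Numerical location of the limit -/

/-- If γa = 1/2 then a = 1/(2γ), so the Cohen equation at δ = γ - 1/(2γ) reads Φ(δ)/φ(δ) = 2γ;
monotonicity of the truncated mean gives the inequalities on both sides. -/
theorem compare_mul_cohenAInfty {γ : ℝ} (hγ : 0 < γ) :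
    (millsR (γ - 1 / (2 * γ)) < 2 * γ ↔ 1 / 2 < γ * cohenAInfty γ) ∧
    (2 * γ < millsR (γ - 1 / (2 * γ)) ↔ γ * cohenAInfty γ < 1 / 2) := by
  have hR := millsR_pos (γ - 1 / (2 * γ))
  have hm := truncMean_sub_cohenAInfty hγ
  have e1 : truncMean (γ - 1 / (2 * γ)) = γ - 1 / (2 * γ) + 1 / millsR (γ - 1 / (2 * γ)) := by
    rw [truncMean, fInfty_eq, one_div (millsR _)]
  constructor
  · rw [← one_div_lt_one_div (by positivity) hR]
    have a1 : 1 / (2 * γ) < 1 / millsR (γ - 1 / (2 * γ)) ↔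
        truncMean (γ - cohenAInfty γ) < truncMean (γ - 1 / (2 * γ)) := by
      rw [hm, e1]; constructor <;> intro <;> linarith
    rw [a1, truncMean_strictMono.lt_iff_lt, sub_lt_sub_iff_left, div_lt_iff₀ (by positivity)]
    constructor <;> intro <;> linarith
  · rw [← one_div_lt_one_div hR (by positivity)]
    have a1 : 1 / millsR (γ - 1 / (2 * γ)) < 1 / (2 * γ) ↔
        truncMean (γ - 1 / (2 * γ)) < truncMean (γ - cohenAInfty γ) := by
      rw [hm, e1]; constructor <;> intro <;> linarith
    rw [a1, truncMean_strictMono.lt_iff_lt, sub_lt_sub_iff_left, lt_div_iff₀ (by positivity)]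
    constructor <;> intro <;> linarith

theorem millsR_strictMono : StrictMono millsR := strictMono_of_deriv_pos fun δ => by
  rw [(hasDerivAt_millsR δ).deriv]
  exact one_add_mul_millsR_pos δ

/-- Partial sum of the power series `∑ x ^ (2 k + 1) / (2 k + 1)!!`, with weight `c` on the last
term. -/
noncomputable def millsSeries (c x : ℝ) : ℝ :=
  x + x ^ 3 / 3 + x ^ 5 / 15 + x ^ 7 / 105 + x ^ 9 / 945 + x ^ 11 / 10395 + x ^ 13 / 135135 +
    c * x ^ 15 / 2027025

theorem hasDerivAt_millsSeries (c x : ℝ) :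
    HasDerivAt (millsSeries c)
      (1 + x * millsSeries c x + (c - 1) * x ^ 14 / 135135 - c * x ^ 16 / 2027025) x := by
  have h := (((((((hasDerivAt_id x).add ((hasDerivAt_pow 3 x).div_const 3)).add
    ((hasDerivAt_pow 5 x).div_const 15)).add ((hasDerivAt_pow 7 x).div_const 105)).add
    ((hasDerivAt_pow 9 x).div_const 945)).add ((hasDerivAt_pow 11 x).div_const 10395)).add
    ((hasDerivAt_pow 13 x).div_const 135135)).add
    (((hasDerivAt_pow 15 x).const_mul c).div_const 2027025)
  refine h.congr_deriv ?_
  unfold millsSeries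
  push_cast
  ring

theorem millsSeries_zero (c : ℝ) : millsSeries c 0 = 0 := by simp [millsSeries]

theorem lower_millsR {δ : ℝ} (h0 : 0 ≤ δ) :
    Real.exp (δ ^ 2 / 2) * √(Real.pi / 2) + millsSeries 1 δ ≤ millsR δ := by
  rw [← millsR_zero]
  refine le_millsR h0 (hasDerivAt_millsSeries 1) (millsSeries_zero 1) fun x hx _ => ?_
  have : 0 ≤ x ^ 16 := by positivity
  linarith

/-- Raising the last weight from 1 to 11/10 turns the truncated series into a supersolution on [0,
1]: the surplus x¹⁴/1351350 outweighs the defect 1.1 x¹⁶/2027025. -/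
theorem upper_millsR {δ : ℝ} (h0 : 0 ≤ δ) (h1 : δ ≤ 1) :
    millsR δ ≤ Real.exp (δ ^ 2 / 2) * √(Real.pi / 2) + millsSeries (11 / 10) δ := by
  rw [← millsR_zero]
  refine millsR_le h0 (hasDerivAt_millsSeries _) (millsSeries_zero _) fun x hx hxδ => ?_
  have h2 : x ^ 16 ≤ x ^ 14 := pow_le_pow_of_le_one hx.le (by linarith) (by norm_num)
  have : 0 ≤ x ^ 14 := by positivity
  linarith

theorem sqrt_pi_div_two_bounds :
    (1.2533141373155 : ℝ) < √(Real.pi / 2) ∧ √(Real.pi / 2) < 1.2533141373156 := by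
  constructor
  · refine Real.lt_sqrt_of_sq_lt ?_
    have := Real.pi_gt_d20
    norm_num at *
    linarith
  · rw [Real.sqrt_lt' (by norm_num)]
    have := Real.pi_lt_d20
    norm_num at *
    linarith

theorem millsR_lt_of_lower : millsR (1.034113459 - 1 / (2 * 1.034113459)) < 2 * 1.034113459 := by
  have h1 : (1.034113459 - 1 / (2 * 1.034113459) : ℝ) < 0.55060751906 := by norm_num
  refine (millsR_strictMono h1).trans ((upper_millsR (by norm_num) (by norm_num)).trans_lt ?_)
  have h2 := Real.exp_bound' (x := 0.55060751906 ^ 2 / 2) (by norm_num) (by norm_num)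
    (n := 9) (by norm_num)
  have h3 : Real.exp (0.55060751906 ^ 2 / 2) ≤ 1.16367641891 := by
    refine h2.trans ?_
    norm_num [Finset.sum_range_succ, Nat.factorial]
  have h4 := mul_le_mul h3 sqrt_pi_div_two_bounds.2.le (Real.sqrt_nonneg _) (by norm_num)
  refine (add_le_add_left h4 _).trans_lt ?_
  norm_num [millsSeries]

theorem lt_millsR_of_upper : 2 * 1.034113460 < millsR (1.034113460 - 1 / (2 * 1.034113460)) := by
  have h1 : (0.55060752052 : ℝ) < 1.034113460 - 1 / (2 * 1.034113460) := by norm_num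
  refine LT.lt.trans ?_ (millsR_strictMono h1)
  refine LT.lt.trans_le ?_ (lower_millsR (by norm_num))
  have h2 := Real.sum_le_exp_of_nonneg (x := 0.55060752052 ^ 2 / 2) (by norm_num) 9
  have h3 : 1.16367641982 ≤ Real.exp (0.55060752052 ^ 2 / 2) := by
    refine le_trans ?_ h2
    norm_num [Finset.sum_range_succ, Nat.factorial]
  have h4 := mul_le_mul h3 sqrt_pi_div_two_bounds.1.le (by norm_num) (Real.exp_pos _).le
  refine LT.lt.trans_le ?_ (add_le_add_left h4 _)
  norm_num [millsSeries]

theorem exists_gammaInfty : ∃ γ : ℝ, 0 < γ ∧ γ * cohenAInfty γ = 1 / 2 ∧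
    1.034113459 ≤ γ ∧ γ < 1.034113460 := by
  have hlo := (compare_mul_cohenAInfty (γ := 1.034113459) (by norm_num)).1.1 millsR_lt_of_lower
  have hhi := (compare_mul_cohenAInfty (γ := 1.034113460) (by norm_num)).2.1 lt_millsR_of_upper
  obtain ⟨δ, hδ⟩ : ∃ δ, truncGap δ = 1 / 2 := by
    rw [mul_cohenAInfty_eq (by norm_num)] at hlo hhi
    have hle := sub_cohenAInfty_strictMonoOn.monotoneOn
      (show (0 : ℝ) < 1.034113459 by norm_num) (show (0 : ℝ) < 1.034113460 by norm_num)
      (by norm_num)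
    obtain ⟨δ, _, h⟩ := intermediate_value_Icc' hle (fun x _ =>
      (((hasDerivAt_truncMean x).mul
        (hasDerivAt_fInfty x)).continuousAt.continuousWithinAt : ContinuousWithinAt truncGap _ x))
      ⟨hhi.le, hlo.le⟩
    exact ⟨δ, h⟩
  have hm := truncMean_pos δ
  have hγ : truncMean δ * cohenAInfty (truncMean δ) = 1 / 2 := by
    rw [mul_cohenAInfty_eq hm, truncMean_strictMono.injective (truncMean_sub_cohenAInfty hm), hδ]
  refine ⟨truncMean δ, hm, hγ, ?_, ?_⟩
  · rw [← hγ] at hlo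
    exact ((mul_cohenAInfty_strictAntiOn.lt_iff_gt hm (by norm_num : (0 : ℝ) < _)).1 hlo).le
  · rw [← hγ] at hhi
    exact (mul_cohenAInfty_strictAntiOn.lt_iff_gt (by norm_num : (0 : ℝ) < _) hm).1 hhi

/-! ### Integral representation and the limit of many servers -/

theorem exp_neg_mul_mul_pow_le (s : ℕ) {p q : ℝ} (hp : 0 < p) (hq : 0 < q) :
    ∃ C > 0, ∀ v : ℝ, 0 ≤ v →
      Real.exp (-(p * v)) * (1 + q * v) ^ s ≤ C * Real.exp (-(p / 2) * v) := by
  -- Small enough that the s-th power of exp(εqv) uses up at most half of the decay exp(-pv).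
  set ε := min 1 (p / (2 * q * (s + 1))) with hε
  have hε0 : 0 < ε := lt_min one_pos (by positivity)
  refine ⟨(ε⁻¹) ^ s, by positivity, fun v hv => ?_⟩
  have h1 : 1 + q * v ≤ ε⁻¹ * Real.exp (ε * (q * v)) := by
    rw [inv_mul_eq_div, le_div_iff₀ hε0]
    have := Real.add_one_le_exp (ε * (q * v))
    have : ε ≤ 1 := min_le_left _ _
    linarith
  have h2 : (s : ℝ) * (ε * (q * v)) ≤ p / 2 * v := by
    have h3 : ε ≤ p / (2 * q * (s + 1)) := min_le_right _ _
    rw [le_div_iff₀ (by positivity)] at h3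
    have h4 : (s : ℝ) * (ε * q) ≤ p / 2 := by
      have : 0 ≤ ε * q := by positivity
      linarith
    calc (s : ℝ) * (ε * (q * v)) = (s : ℝ) * (ε * q) * v := by ring
      _ ≤ _ := mul_le_mul_of_nonneg_right h4 hv
  calc Real.exp (-(p * v)) * (1 + q * v) ^ s
      ≤ Real.exp (-(p * v)) * (ε⁻¹ * Real.exp (ε * (q * v))) ^ s := by gcongr
    _ = (ε⁻¹) ^ s * Real.exp (-(p * v) + s * (ε * (q * v))) := by
        rw [mul_pow, ← Real.exp_nat_mul, Real.exp_add]; ring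
    _ ≤ (ε⁻¹) ^ s * Real.exp (-(p / 2) * v) := by
        gcongr; linarith

theorem integrableOn_exp_neg_mul_mul_pow (s : ℕ) {p q : ℝ} (hp : 0 < p) (hq : 0 < q) :
    MeasureTheory.IntegrableOn (fun v : ℝ => Real.exp (-(p * v)) * (1 + q * v) ^ s) (Ioi 0) := by
  obtain ⟨C, _, h⟩ := exp_neg_mul_mul_pow_le s hp hq
  refine MeasureTheory.Integrable.mono'
    ((exp_neg_integrableOn_Ioi 0 (by positivity : 0 < p / 2)).const_mul C)
    (Continuous.aestronglyMeasurable (by fun_prop)) ?_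
  filter_upwards [MeasureTheory.ae_restrict_mem measurableSet_Ioi] with v hv
  have hv : 0 < v := hv
  rw [Real.norm_of_nonneg (by positivity)]
  exact h v hv.le

theorem tendsto_exp_neg_mul_mul_pow (s : ℕ) {p q : ℝ} (hp : 0 < p) (hq : 0 < q) :
    Tendsto (fun v : ℝ => Real.exp (-(p * v)) * (1 + q * v) ^ s) atTop (𝓝 0) := by
  obtain ⟨C, _, h⟩ := exp_neg_mul_mul_pow_le s hp hq
  have hlim : Tendsto (fun v : ℝ => C * Real.exp (-(p / 2) * v)) atTop (𝓝 0) := by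
    have h1 : Tendsto (fun v : ℝ => -(p / 2) * v) atTop atBot :=
      tendsto_id.const_mul_atTop_of_neg (by linarith)
    simpa using (Real.tendsto_exp_atBot.comp h1).const_mul C
  refine squeeze_zero' ?_ ?_ hlim
  · filter_upwards [eventually_ge_atTop 0] with v hv
    positivity
  · filter_upwards [eventually_ge_atTop 0] with v hv
    exact h v hv

/-- The integral representation of the reciprocal Erlang B formula. -/
theorem erlangR_eq_integral (s : ℕ) {p q : ℝ} (hp : 0 < p) (hq : 0 < q) :
    erlangR s (p / q) = p * ∫ v in Ioi (0 : ℝ), Real.exp (-(p * v)) * (1 + q * v) ^ s := by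
  have hexp : ∀ v : ℝ, HasDerivAt (fun v : ℝ => Real.exp (-(p * v)))
      (Real.exp (-(p * v)) * -p) v := fun v =>
    HasDerivAt.exp (((hasDerivAt_id v).const_mul p).neg.congr_deriv (by simp))
  have hlin : ∀ v : ℝ, HasDerivAt (fun v : ℝ => 1 + q * v) q v := fun v =>
    (((hasDerivAt_id v).const_mul q).const_add 1).congr_deriv (by simp)
  induction s with
  | zero =>
    have h := MeasureTheory.integral_Ioi_of_hasDerivAt_of_tendsto (a := 0)
      (hexp 0).continuousAt.continuousWithinAt (fun v _ => hexp v)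
      (by simpa only [pow_zero, mul_one, MeasureTheory.IntegrableOn] using
        (integrableOn_exp_neg_mul_mul_pow 0 hp hq).mul_const (-p))
      (by simpa only [pow_zero, mul_one] using tendsto_exp_neg_mul_mul_pow 0 hp hq)
    rw [MeasureTheory.integral_mul_const] at h
    simp only [erlangR, pow_zero, mul_one]
    simp only [mul_zero, neg_zero, Real.exp_zero, zero_sub] at h
    linarith
  | succ s ih =>
    have i1 := (integrableOn_exp_neg_mul_mul_pow s hp hq).const_mul ((s + 1) * q)
    have i2 := (integrableOn_exp_neg_mul_mul_pow (s + 1) hp hq).const_mul p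
    have hd : ∀ v : ℝ, HasDerivAt (fun v : ℝ => Real.exp (-(p * v)) * (1 + q * v) ^ (s + 1))
        ((s + 1) * q * (Real.exp (-(p * v)) * (1 + q * v) ^ s) -
          p * (Real.exp (-(p * v)) * (1 + q * v) ^ (s + 1))) v := fun v => by
      refine ((hexp v).mul ((hlin v).pow (s + 1))).congr_deriv ?_
      simp only [Pi.pow_apply, Nat.add_sub_cancel]
      push_cast
      ring
    have h := MeasureTheory.integral_Ioi_of_hasDerivAt_of_tendsto (a := 0)
      (hd 0).continuousAt.continuousWithinAt (fun v _ => hd v)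
      (MeasureTheory.Integrable.sub' i1 i2) (tendsto_exp_neg_mul_mul_pow (s + 1) hp hq)
    rw [MeasureTheory.integral_sub i1 i2, MeasureTheory.integral_const_mul,
      MeasureTheory.integral_const_mul] at h
    simp only [mul_zero, neg_zero, Real.exp_zero, add_zero, one_pow, mul_one] at h
    rw [erlangR_succ, ih]
    have e : ((s : ℝ) + 1) / (p / q) *
        (p * ∫ v in Ioi (0 : ℝ), Real.exp (-(p * v)) * (1 + q * v) ^ s) =
        (s + 1) * q * ∫ v in Ioi (0 : ℝ), Real.exp (-(p * v)) * (1 + q * v) ^ s := by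
      field_simp
    rw [e]
    linarith

/-- With x = v/σ, the bounds are x - x²/2 ≤ 2x/(x + 2) ≤ log(1 + x), and log y ≤ sinh(log y) = (y -
1/y)/2 for y = 1 + x. -/
theorem one_add_pow_bounds {s : ℕ} {σ v : ℝ} (hσ : 0 < σ) (hσs : σ ^ 2 = s) (hv : 0 ≤ v) :
    Real.exp (σ * v - v ^ 2 / 2) ≤ (1 + 1 / σ * v) ^ s ∧
      (1 + 1 / σ * v) ^ s ≤ Real.exp (σ * v - v ^ 2 / (2 * (1 + v / σ))) := by
  have hx : 0 ≤ v / σ := by positivity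
  have h1 : (1 + 1 / σ * v) ^ s = Real.exp (σ ^ 2 * Real.log (1 + v / σ)) := by
    rw [hσs, Real.exp_nat_mul, Real.exp_log (by positivity)]
    congr 1; ring
  rw [h1, Real.exp_le_exp, Real.exp_le_exp]
  constructor
  · have h2 := Real.le_log_one_add_of_nonneg hx
    have h3 : v / σ - (v / σ) ^ 2 / 2 ≤ 2 * (v / σ) / (v / σ + 2) := by
      rw [le_div_iff₀ (by positivity)]
      have : 0 ≤ (v / σ) ^ 3 := by positivity
      nlinarith
    have e : σ * v - v ^ 2 / 2 = σ ^ 2 * (v / σ - (v / σ) ^ 2 / 2) := by field_simp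
    rw [e]
    exact mul_le_mul_of_nonneg_left (h3.trans h2) (by positivity)
  · have h2 : Real.log (1 + v / σ) ≤ (1 + v / σ - (1 + v / σ)⁻¹) / 2 := by
      rw [← Real.sinh_log (by positivity)]
      exact Real.self_le_sinh_iff.2 (Real.log_nonneg (by linarith))
    have e : σ * v - v ^ 2 / (2 * (1 + v / σ)) =
        σ ^ 2 * ((1 + v / σ - (1 + v / σ)⁻¹) / 2) := by
      field_simp; ring
    rw [e]
    exact mul_le_mul_of_nonneg_left h2 (by positivity)

theorem tendsto_sqrt_natCast : Tendsto (fun s : ℕ => √(s : ℝ)) atTop atTop :=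
  Real.tendsto_sqrt_atTop.comp tendsto_natCast_atTop_atTop

/-- The Halfin–Whitt limit of the Erlang B formula, in integral form. -/
theorem tendsto_integral_exp_neg_mul_mul_pow (δ : ℝ) :
    Tendsto (fun s : ℕ => ∫ v in Ioi (0 : ℝ),
      Real.exp (-((√(s : ℝ) - δ - 1 / (2 * √(s : ℝ))) * v)) * (1 + 1 / √(s : ℝ) * v) ^ s)
      atTop (𝓝 (millsR δ)) := by
  -- For √s ≥ b the quadratic term is at least b(v - b)/2 = (|δ| + 2)v - b²/2. This absorbs the
  -- linear terms δv and v/(2σ) ≤ v and leaves the dominating function exp(b²/2 - v).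
  set b : ℝ := 2 * (|δ| + 2) with hb
  have hb0 : 0 < b := by positivity
  rw [millsR, millsMoment]
  refine MeasureTheory.tendsto_integral_filter_of_dominated_convergence
    (fun v => Real.exp (b ^ 2 / 2) * Real.exp (-1 * v)) ?_ ?_
    ((exp_neg_integrableOn_Ioi 0 one_pos).const_mul _) ?_
  · exact Eventually.of_forall fun s => Continuous.aestronglyMeasurable (by fun_prop)
  · filter_upwards [tendsto_sqrt_natCast.eventually_ge_atTop b] with s hs
    filter_upwards [MeasureTheory.ae_restrict_mem measurableSet_Ioi] with v hv
    have hv : 0 < v := hv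
    set σ := √(s : ℝ) with hσ
    have hσ0 : 0 < σ := hb0.trans_le hs
    have hσs : σ ^ 2 = s := Real.sq_sqrt (Nat.cast_nonneg s)
    rw [Real.norm_of_nonneg (by positivity)]
    refine (mul_le_mul_of_nonneg_left (one_add_pow_bounds hσ0 hσs hv.le).2
      (Real.exp_pos _).le).trans ?_
    rw [← Real.exp_add, ← Real.exp_add, Real.exp_le_exp]
    have h1 : b * (v - b) / 2 ≤ v ^ 2 / (2 * (1 + v / σ)) := by
      have h2 : v / σ ≤ v / b := div_le_div_of_nonneg_left hv.le hb0 hs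
      have h3 : v ^ 2 / (2 * (1 + v / b)) ≤ v ^ 2 / (2 * (1 + v / σ)) := by gcongr
      refine le_trans ?_ h3
      rw [le_div_iff₀ (by positivity)]
      have e : b * (v - b) / 2 * (2 * (1 + v / b)) = v ^ 2 - b ^ 2 := by field_simp; ring
      rw [e]; nlinarith
    have h4 : 1 / (2 * σ) ≤ 1 := by
      rw [div_le_one (by positivity)]
      have := abs_nonneg δ
      linarith
    have h5 : δ * v ≤ |δ| * v := mul_le_mul_of_nonneg_right (le_abs_self δ) hv.le
    have h6 : 1 / (2 * σ) * v ≤ 1 * v := mul_le_mul_of_nonneg_right h4 hv.le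
    have h7 : b * (v - b) / 2 = |δ| * v + 2 * v - b ^ 2 / 2 := by
      rw [hb]; ring
    linarith
  · filter_upwards [MeasureTheory.ae_restrict_mem measurableSet_Ioi] with v hv
    have hv : 0 < v := hv
    have hi : Tendsto (fun s : ℕ => (√(s : ℝ))⁻¹) atTop (𝓝 0) :=
      tendsto_inv_atTop_zero.comp tendsto_sqrt_natCast
    have hlo : Tendsto (fun s : ℕ => Real.exp (δ * v + (√(s : ℝ))⁻¹ * (v / 2) - v ^ 2 / 2)) atTop
        (𝓝 (v ^ 0 * Real.exp (δ * v - v ^ 2 / 2))) := by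
      have h := ((hi.mul_const (v / 2)).const_add (δ * v)).sub_const (v ^ 2 / 2)
      simpa [Function.comp_def] using (Real.continuous_exp.tendsto _).comp h
    have hhi : Tendsto (fun s : ℕ => Real.exp (δ * v + (√(s : ℝ))⁻¹ * (v / 2) -
        v ^ 2 / (2 * (1 + v * (√(s : ℝ))⁻¹)))) atTop
        (𝓝 (v ^ 0 * Real.exp (δ * v - v ^ 2 / 2))) := by
      have h1 : Tendsto (fun s : ℕ => 2 * (1 + v * (√(s : ℝ))⁻¹)) atTop (𝓝 2) := by
        simpa using ((hi.const_mul v).const_add 1).const_mul 2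
      have h := ((hi.mul_const (v / 2)).const_add (δ * v)).sub
        ((tendsto_const_nhds (x := v ^ 2)).div h1 two_ne_zero)
      simpa [Function.comp_def] using (Real.continuous_exp.tendsto _).comp h
    refine tendsto_of_tendsto_of_tendsto_of_le_of_le' hlo hhi ?_ ?_
    all_goals
      filter_upwards [tendsto_sqrt_natCast.eventually_gt_atTop 0] with s hσ0
      have hσs : √(s : ℝ) ^ 2 = s := Real.sq_sqrt (Nat.cast_nonneg s)
      have hbd := one_add_pow_bounds hσ0 hσs hv.le
      generalize √(s : ℝ) = σ at *
    · refine le_trans (le_of_eq ?_) (mul_le_mul_of_nonneg_left hbd.1 (Real.exp_pos _).le)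
      rw [← Real.exp_add]
      congr 1
      field_simp
      ring
    · refine le_trans (mul_le_mul_of_nonneg_left hbd.2 (Real.exp_pos _).le) (le_of_eq ?_)
      rw [← Real.exp_add, div_eq_mul_inv v σ]
      congr 1
      have : 1 / (2 * σ) = σ⁻¹ / 2 := by field_simp
      rw [this]
      ring

theorem tendsto_erlangR_critRate {γ : ℝ} (hγ : 0 < γ) :
    Tendsto (fun s : ℕ => erlangR s (critRate s (γ * √(s : ℝ))) / √(s : ℝ)) atTop
      (𝓝 (millsR (γ - 1 / (2 * γ)))) := by
  set δ := γ - 1 / (2 * γ) with hδ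
  have hi : Tendsto (fun s : ℕ => (√(s : ℝ))⁻¹) atTop (𝓝 0) :=
    tendsto_inv_atTop_zero.comp tendsto_sqrt_natCast
  have h1 : Tendsto (fun s : ℕ => 1 - δ * (√(s : ℝ))⁻¹ - 1 / 2 * (√(s : ℝ))⁻¹ ^ 2) atTop (𝓝 1) := by
    simpa using ((hi.const_mul δ).const_sub 1).sub ((hi.pow 2).const_mul 2⁻¹)
  have h2 := h1.mul (tendsto_integral_exp_neg_mul_mul_pow δ)
  rw [one_mul] at h2
  refine h2.congr' ?_
  filter_upwards [tendsto_sqrt_natCast.eventually_gt_atTop γ] with s hs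
  set σ := √(s : ℝ) with hσ
  have hσ0 : 0 < σ := hγ.trans hs
  have hσs : σ ^ 2 = s := Real.sq_sqrt (Nat.cast_nonneg s)
  -- The critical rate is exactly s - δ√s - 1/2, which places it in the Halfin–Whitt regime.
  have e1 : critRate s (γ * σ) = (σ - δ - 1 / (2 * σ)) / (1 / σ) := by
    rw [← hσs, critRate_sq hσ0.ne', hδ]
    field_simp
    ring
  have hp : 0 < σ - δ - 1 / (2 * σ) := by
    have e2 : σ - δ - 1 / (2 * σ) = (σ - γ) * (1 + 2 * γ * σ) / (2 * γ * σ) := by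
      rw [hδ]; field_simp; ring
    have : 0 < σ - γ := by linarith
    rw [e2]; positivity
  rw [e1, erlangR_eq_integral s hp (by positivity)]
  field_simp

theorem tendsto_gammaHat {γ₀ : ℝ} (h0 : 0 < γ₀) (h : γ₀ * cohenAInfty γ₀ = 1 / 2) :
    Tendsto gammaHat atTop (𝓝 γ₀) := by
  have hanti := mul_cohenAInfty_strictAntiOn
  refine tendsto_order.2 ⟨fun γ hγ => ?_, fun γ hγ => ?_⟩
  · rcases le_or_gt γ 0 with hneg | hpos
    · filter_upwards [eventually_ge_atTop 1] with s hs
      exact hneg.trans_lt (gammaHat_mem hs).1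
    · have h1 := hanti (show γ ∈ Ioi 0 from hpos) h0 hγ
      simp only [h] at h1
      have h2 := (compare_mul_cohenAInfty hpos).1.2 h1
      filter_upwards [eventually_ge_atTop 1, tendsto_sqrt_natCast.eventually_gt_atTop γ,
        (tendsto_erlangR_critRate hpos).eventually_lt_const h2] with s hs hσ hlt
      refine (compare_gammaHat hs ⟨hpos, hσ⟩).1.1 ?_
      rw [div_lt_iff₀ (hpos.trans hσ)] at hlt
      linarith
  · have hpos : 0 < γ := h0.trans hγ
    have h1 := hanti h0 (show γ ∈ Ioi 0 from hpos) hγ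
    simp only [h] at h1
    have h2 := (compare_mul_cohenAInfty hpos).2.2 h1
    -- After division by √s the threshold 1 + 2γ√s exceeds 2γ by 1/√s, which matters only on this
    -- side.
    have hi : Tendsto (fun s : ℕ => (√(s : ℝ))⁻¹ + 2 * γ) atTop (𝓝 (2 * γ)) := by
      simpa using (tendsto_inv_atTop_zero.comp tendsto_sqrt_natCast).add_const (2 * γ)
    filter_upwards [eventually_ge_atTop 1, tendsto_sqrt_natCast.eventually_gt_atTop γ,
      hi.eventually_lt (tendsto_erlangR_critRate hpos) h2] with s hs hσ hlt
    refine (compare_gammaHat hs ⟨hpos, hσ⟩).2.1 ?_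
    have hσ0 := hpos.trans hσ
    rw [lt_div_iff₀ hσ0, add_mul, inv_mul_cancel₀ hσ0.ne'] at hlt
    linarith

/-- The first three clauses say that `a_s(γ)`, `a_∞(γ)` and `γ̂_s` are well defined. -/
theorem mainTheorem10 :
    (∀ s : ℕ, 1 ≤ s → ∀ γ ∈ Ioo (0 : ℝ) (√(s : ℝ)), ∃! a : ℝ, IsCohenSol s γ a) ∧
    (∀ γ : ℝ, 0 < γ → ∃! a : ℝ, a = fInfty (γ - a)) ∧
    (∀ s : ℕ, 1 ≤ s → ∃! γ : ℝ, IsMaximizerL s γ) ∧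
    StrictMonoOn gammaHat (Ici 1) ∧
    gammaHat 1 = 1 / 2 ∧
    StrictAntiOn (fun γ : ℝ => γ * cohenAInfty γ) (Ioi 0) ∧
    Tendsto (fun γ : ℝ => γ * cohenAInfty γ) (𝓝[>] 0) (𝓝 1) ∧
    Tendsto (fun γ : ℝ => γ * cohenAInfty γ) atTop (𝓝 0) ∧
    ∃ γinf : ℝ,
      (0 < γinf ∧ γinf * cohenAInfty γinf = 1 / 2) ∧
      (∀ γ : ℝ, 0 < γ → γ * cohenAInfty γ = 1 / 2 → γ = γinf) ∧
      Tendsto gammaHat atTop (𝓝 γinf) ∧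
      (1.034113459 : ℝ) ≤ γinf ∧ γinf < (1.034113460 : ℝ) := by
  obtain ⟨γ₀, h0, h, hlo, hhi⟩ := exists_gammaInfty
  exact ⟨fun s hs γ hγ => existsUnique_isCohenSol hs hγ, fun γ hγ => existsUnique_cohenInfty hγ,
    fun s hs => existsUnique_isMaximizerL hs, gammaHat_strictMonoOn, gammaHat_one,
    mul_cohenAInfty_strictAntiOn, tendsto_mul_cohenAInfty_zero, tendsto_mul_cohenAInfty_atTop,
    γ₀, ⟨h0, h⟩, fun γ hγ he => mul_cohenAInfty_strictAntiOn.injOn hγ h0 (he.trans h.symm),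
    tendsto_gammaHat h0 h, hlo, hhi⟩
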